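/- Let $G$ be a connected solvable real Lie group, $\Gamma\subset G$ a discrete subgroup such that $M=\Gamma\backslash G$ is compact, and $J$ a left-invariant complex structure on $M$, i.e. an integrable almost complex structure whose pull-back to $G$ is invariant under left translations. Let $g$ be a left-invariant $J$-Hermitian metric on $M$ (its pull-back to $G$ is invariant under left translations), with fundamental form $\omega=g(J\cdot,\cdot)$. Call a smooth one-form $\theta$ on $M$ a Lee form of $g$ if $d\theta=0$ and $d\omega=\theta\wedge\omega$ (it is unique if $\dim_{\mathbb C}M\ge 2$), and put $d_\theta=d-\theta\wedge\cdot\,$. Suppose that $g$ is lcK with potential: there are a Lee form $\theta$ of $g$ and a function $f\in C^\infty(M,\mathbb R)$ with $$\omega=d_\theta\,J\,d_\theta f,$$ where $(J\alpha)(v)=-\alpha(Jv)$ for a one-form $\alpha$. Then $g$ is Vaisman, i.e. $g$ has a Lee form that is parallel with respect to the Levi-Civita connection of $g$. -/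

import Mathlib

open scoped Manifold ContDiff Topology Bundle

noncomputable section

namespace LcK

/-! ### The quotient manifold `Γ \ G` -/

section Quotient

variable {E : Type*} [NormedAddCommGroup E] [NormedSpace ℝ E]
  {G : Type*} [TopologicalSpace G] [ChartedSpace E G] [Group G]

/-- The space `Γ \ G` of the cosets `Γ g`, with the quotient topology: `x` and `y` are identified
if and only if `y * x⁻¹ ∈ Γ`. -/
def LeftQuotient (Γ : Subgroup G) : Type _ := Quotient (QuotientGroup.rightRel Γ)

instance (Γ : Subgroup G) : TopologicalSpace (LeftQuotient Γ) :=
  inferInstanceAs (TopologicalSpace (Quotient (QuotientGroup.rightRel Γ)))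

/-- The projection `G → Γ \ G`. -/
def proj (Γ : Subgroup G) (x : G) : LeftQuotient Γ := Quotient.mk (QuotientGroup.rightRel Γ) x

theorem proj_surjective (Γ : Subgroup G) : Function.Surjective (proj Γ) := Quotient.mk_surjective

theorem proj_eq_iff (Γ : Subgroup G) {x y : G} : proj Γ x = proj Γ y ↔ y * x⁻¹ ∈ Γ :=
  Quotient.eq.trans QuotientGroup.rightRel_apply

theorem proj_mul_left (Γ : Subgroup G) {γ : G} (hγ : γ ∈ Γ) (x : G) :
    proj Γ (γ * x) = proj Γ x := by
  rw [eq_comm, proj_eq_iff]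
  simpa using hγ

theorem isLocalHomeomorph_proj [LieGroup 𝓘(ℝ, E) ∞ G] (Γ : Subgroup G) [DiscreteTopology Γ] :
    IsLocalHomeomorph (proj Γ) := by
  have : IsTopologicalGroup G := topologicalGroup_of_lieGroup 𝓘(ℝ, E) ∞
  have hq : Topology.IsQuotientMap (proj Γ) := isQuotientMap_quotient_mk'
  exact (hq.isQuotientCoveringMap_of_subgroup Γ ⟨inferInstance⟩
    (fun {_ _} ↦ proj_eq_iff Γ)).isCoveringMap.isLocalHomeomorph

/-- The atlas of `Γ \ G`: its charts are the charts of `G` composed with the local inverses of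
the projection. -/
instance [LieGroup 𝓘(ℝ, E) ∞ G] (Γ : Subgroup G) [DiscreteTopology Γ] :
    ChartedSpace E (LeftQuotient Γ) :=
  (isLocalHomeomorph_proj (E := E) Γ).chartedSpace (proj_surjective Γ)

theorem contMDiffOn_localInverseAt_comp_proj [LieGroup 𝓘(ℝ, E) ∞ G] (Γ : Subgroup G)
    [DiscreteTopology Γ] (x : G) :
    ContMDiffOn 𝓘(ℝ, E) 𝓘(ℝ, E) ∞
      (fun y ↦ (isLocalHomeomorph_proj (E := E) Γ).localInverseAt x (proj Γ y))
      (proj Γ ⁻¹' ((isLocalHomeomorph_proj (E := E) Γ).localInverseAt x).source) := by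
  have : IsTopologicalGroup G := topologicalGroup_of_lieGroup 𝓘(ℝ, E) ∞
  set hf := isLocalHomeomorph_proj (E := E) Γ
  intro y hy
  set z := hf.localInverseAt x (proj Γ y) with hz
  have hzy : proj Γ z = proj Γ y := hf.apply_localInverseAt_of_mem hy
  have hγ : z * y⁻¹ ∈ Γ := (proj_eq_iff Γ).1 hzy.symm
  have hzt : z ∈ (hf.localInverseAt x).target := (hf.localInverseAt x).map_source hy
  have hsm : ContMDiffAt 𝓘(ℝ, E) 𝓘(ℝ, E) ∞ (fun w : G ↦ (z * y⁻¹) * w) y :=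
    (contMDiff_mul_left (I := 𝓘(ℝ, E)) (n := ∞) (a := z * y⁻¹)).contMDiffAt
  refine (hsm.congr_of_eventuallyEq ?_).contMDiffWithinAt
  have hcont : ContinuousAt (fun w : G ↦ (z * y⁻¹) * w) y := by fun_prop
  have hmem : (hf.localInverseAt x).target ∈ 𝓝 ((z * y⁻¹) * y) := by
    simpa using (hf.localInverseAt x).open_target.mem_nhds hzt
  filter_upwards [hcont hmem] with w hw
  have hw' : (z * y⁻¹) * w ∈ (hf.localInverseAt x).target := hw
  have h2 := (hf.localInverseAt x).right_inv hw'
  rw [hf.localInverseAt_symm, proj_mul_left Γ hγ] at h2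
  exact h2

instance [LieGroup 𝓘(ℝ, E) ∞ G] (Γ : Subgroup G) [DiscreteTopology Γ] :
    IsManifold 𝓘(ℝ, E) ∞ (LeftQuotient Γ) := by
  refine isManifold_of_contDiffOn _ _ _ ?_
  rintro _ _ ⟨q, rfl⟩ ⟨q', rfl⟩
  set hf := isLocalHomeomorph_proj (E := E) Γ
  set x := (proj_surjective Γ).hasRightInverse.choose q
  set x' := (proj_surjective Γ).hasRightInverse.choose q'
  rw [← contMDiffOn_iff_contDiffOn]
  have h1 := contMDiffOn_chart_symm (I := 𝓘(ℝ, E)) (n := ∞) (x := x) (H := E) (M := G)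
  have h2 := contMDiffOn_chart (I := 𝓘(ℝ, E)) (n := ∞) (x := x') (H := E) (M := G)
  have h3 := contMDiffOn_localInverseAt_comp_proj (E := E) Γ x'
  refine (h2.comp (h3.comp (h1.mono (t := _) ?_) ?_) ?_).congr ?_
  all_goals
    intro w hw
    simp at hw ⊢
    try tauto

theorem isLocalDiffeomorph_proj [LieGroup 𝓘(ℝ, E) ∞ G] (Γ : Subgroup G) [DiscreteTopology Γ] :
    IsLocalDiffeomorph 𝓘(ℝ, E) 𝓘(ℝ, E) ∞ (proj Γ) := by
  set hf := isLocalHomeomorph_proj (E := E) Γ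
  set s : LeftQuotient Γ → G := (proj_surjective Γ).hasRightInverse.choose with hs
  have hsp : ∀ p, proj Γ (s p) = p := (proj_surjective Γ).hasRightInverse.choose_spec
  have hchart : ∀ p, chartAt E p = (hf.localInverseAt (s p)).trans (chartAt E (s p)) :=
    fun p ↦ rfl
  have hmem : ∀ p, p ∈ (hf.localInverseAt (s p)).source := fun p ↦ by
    simpa [hsp p] using hf.apply_self_mem_localInverseAt_source (x := s p)
  have hval : ∀ p, hf.localInverseAt (s p) p = s p := fun p ↦ by
    have := hf.localInverseAt_apply_self (x := s p)
    rwa [hsp p] at this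
  have hs1 : ∀ p, ContMDiffAt 𝓘(ℝ, E) 𝓘(ℝ, E) ∞ (hf.localInverseAt (s p)) p := fun p ↦ by
    have h1 : ContMDiffAt 𝓘(ℝ, E) 𝓘(ℝ, E) ∞ (chartAt E p) p :=
      contMDiffOn_chart.contMDiffAt ((chartAt E p).open_source.mem_nhds (mem_chart_source E p))
    have h2 : ContMDiffAt 𝓘(ℝ, E) 𝓘(ℝ, E) ∞ (chartAt E (s p)).symm (chartAt E p p) := by
      refine contMDiffOn_chart_symm.contMDiffAt ((chartAt E (s p)).open_target.mem_nhds ?_)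
      rw [hchart]
      simp [hval p]
    refine (h2.comp p h1).congr_of_eventuallyEq ?_
    filter_upwards [(chartAt E p).open_source.mem_nhds (mem_chart_source E p)] with w hw
    rw [hchart] at hw ⊢
    simp at hw ⊢
    exact ((chartAt E (s p)).left_inv hw.2).symm
  have hs2 : ∀ x : G, ContMDiffOn 𝓘(ℝ, E) 𝓘(ℝ, E) ∞ (hf.localInverseAt x)
      (hf.localInverseAt x).source := fun x p hp ↦ by
    have hpre : proj Γ ⁻¹' (hf.localInverseAt x).source ∈ 𝓝 (s p) :=
      hf.continuous.continuousAt ((hf.localInverseAt x).open_source.mem_nhds (by rwa [hsp p]))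
    have h3 := (contMDiffOn_localInverseAt_comp_proj (E := E) Γ x).contMDiffAt hpre
    have h4 : ContMDiffAt 𝓘(ℝ, E) 𝓘(ℝ, E) ∞
        ((fun y ↦ hf.localInverseAt x (proj Γ y)) ∘ hf.localInverseAt (s p)) p :=
      ContMDiffAt.comp p (by rw [hval p]; exact h3) (hs1 p)
    refine (h4.congr_of_eventuallyEq ?_).contMDiffWithinAt
    filter_upwards [(hf.localInverseAt (s p)).open_source.mem_nhds (hmem p)] with w hw
    simp [hf.apply_localInverseAt_of_mem hw]
  have hp : ContMDiff 𝓘(ℝ, E) 𝓘(ℝ, E) ∞ (proj Γ) := fun x ↦ by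
    set p := proj Γ x with hpx
    have hpre : proj Γ ⁻¹' (hf.localInverseAt (s p)).source ∈ 𝓝 x :=
      hf.continuous.continuousAt ((hf.localInverseAt (s p)).open_source.mem_nhds (hmem p))
    have h3 := (contMDiffOn_localInverseAt_comp_proj (E := E) Γ (s p)).contMDiffAt hpre
    have h4 : ContMDiffAt 𝓘(ℝ, E) 𝓘(ℝ, E) ∞ (chartAt E (s p)) (s p) :=
      contMDiffOn_chart.contMDiffAt
        ((chartAt E (s p)).open_source.mem_nhds (mem_chart_source E (s p)))
    have h5 : ContMDiffAt 𝓘(ℝ, E) 𝓘(ℝ, E) ∞ (chartAt E p).symm (chartAt E (s p) (s p)) := by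
      refine contMDiffOn_chart_symm.contMDiffAt ((chartAt E p).open_target.mem_nhds ?_)
      have := (chartAt E p).map_source (mem_chart_source E p)
      rw [hchart] at this ⊢
      simpa [hval p] using this
    have hx : hf.localInverseAt (s p) (proj Γ x) = s p := hval p
    have h6 := ContMDiffAt.comp x (g := chartAt E (s p)) (by rw [hx]; exact h4) h3
    have h7 := ContMDiffAt.comp x (g := (chartAt E p).symm)
      (by simp only [Function.comp]; rw [hx]; exact h5) h6
    refine h7.congr_of_eventuallyEq ?_
    have hc : proj Γ ⁻¹' (chartAt E p).source ∈ 𝓝 x :=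
      hf.continuous.continuousAt ((chartAt E p).open_source.mem_nhds (mem_chart_source E p))
    filter_upwards [hc] with w hw
    exact ((chartAt E p).left_inv hw).symm
  intro x
  refine ⟨{ (hf.localInverseAt x).symm with
    open_source := (hf.localInverseAt x).open_target
    open_target := (hf.localInverseAt x).open_source
    contMDiffOn_toFun := ?_
    contMDiffOn_invFun := hs2 x }, hf.self_mem_localInverseAt_target, ?_⟩
  · refine hp.contMDiffOn.congr fun w _ ↦ ?_
    exact congrFun (hf.localInverseAt_symm x) w
  · intro w _
    exact (congrFun (hf.localInverseAt_symm x) w).symm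

end Quotient

/-! ### Geometry on a smooth manifold `M`

Tensor fields are dependent functions on `M`; identities between differential forms are tested, at
each point `x`, on vector fields that are smooth near `x`. -/

section Geometry

variable {E : Type*} [NormedAddCommGroup E] [NormedSpace ℝ E]
  {M : Type*} [TopologicalSpace M] [ChartedSpace E M]

/-- The vector field `X` is smooth at `x`. -/
def SmoothAt [IsManifold 𝓘(ℝ, E) ∞ M] (X : ∀ x : M, TangentSpace 𝓘(ℝ, E) x) (x : M) : Prop :=
  ContMDiffAt 𝓘(ℝ, E) 𝓘(ℝ, E).tangent ∞
    (fun y ↦ (⟨y, X y⟩ : TangentBundle 𝓘(ℝ, E) M)) x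

/-- The vector field `X` is differentiable at `x`. -/
def DiffAt [IsManifold 𝓘(ℝ, E) ∞ M] (X : ∀ x : M, TangentSpace 𝓘(ℝ, E) x) (x : M) : Prop :=
  MDifferentiableAt 𝓘(ℝ, E) 𝓘(ℝ, E).tangent
    (fun y ↦ (⟨y, X y⟩ : TangentBundle 𝓘(ℝ, E) M)) x

/-- The one-form `θ` is smooth. -/
def IsSmoothForm [IsManifold 𝓘(ℝ, E) ∞ M] (θ : ∀ x : M, TangentSpace 𝓘(ℝ, E) x →L[ℝ] ℝ) : Prop :=
  ContMDiff 𝓘(ℝ, E) (𝓘(ℝ, E).prod 𝓘(ℝ, E →L[ℝ] ℝ)) ∞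
    (fun x ↦ Bundle.TotalSpace.mk' (E →L[ℝ] ℝ)
      (E := fun x : M ↦ TangentSpace 𝓘(ℝ, E) x →L[ℝ] ℝ) x (θ x))

/-- The field `J` of endomorphisms of the tangent spaces is smooth. -/
def IsSmoothEndo [IsManifold 𝓘(ℝ, E) ∞ M]
    (J : ∀ x : M, TangentSpace 𝓘(ℝ, E) x →L[ℝ] TangentSpace 𝓘(ℝ, E) x) : Prop :=
  ContMDiff 𝓘(ℝ, E) (𝓘(ℝ, E).prod 𝓘(ℝ, E →L[ℝ] E)) ∞
    (fun x ↦ Bundle.TotalSpace.mk' (E →L[ℝ] E)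
      (E := fun x : M ↦ TangentSpace 𝓘(ℝ, E) x →L[ℝ] TangentSpace 𝓘(ℝ, E) x) x (J x))

/-- The exterior derivative of a one-form `θ`, at the point `x`, on vector fields:
`dθ(X, Y) = X(θ(Y)) - Y(θ(X)) - θ([X, Y])`. -/
def extDeriv₁ (θ : ∀ x : M, TangentSpace 𝓘(ℝ, E) x →L[ℝ] ℝ)
    (X Y : ∀ x : M, TangentSpace 𝓘(ℝ, E) x) (x : M) : ℝ :=
  mvfderiv 𝓘(ℝ, E) (fun y ↦ θ y (Y y)) x (X x)
    - mvfderiv 𝓘(ℝ, E) (fun y ↦ θ y (X y)) x (Y x)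
    - θ x (VectorField.mlieBracket 𝓘(ℝ, E) X Y x)

/-- The exterior derivative of a two-form `σ`, at the point `x`, on vector fields:
`dσ(X, Y, Z) = X(σ(Y, Z)) - Y(σ(X, Z)) + Z(σ(X, Y)) - σ([X, Y], Z) + σ([X, Z], Y) - σ([Y, Z], X)`. -/
def extDeriv₂ (σ : ∀ x : M, TangentSpace 𝓘(ℝ, E) x → TangentSpace 𝓘(ℝ, E) x → ℝ)
    (X Y Z : ∀ x : M, TangentSpace 𝓘(ℝ, E) x) (x : M) : ℝ :=
  mvfderiv 𝓘(ℝ, E) (fun y ↦ σ y (Y y) (Z y)) x (X x)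
    - mvfderiv 𝓘(ℝ, E) (fun y ↦ σ y (X y) (Z y)) x (Y x)
    + mvfderiv 𝓘(ℝ, E) (fun y ↦ σ y (X y) (Y y)) x (Z x)
    - σ x (VectorField.mlieBracket 𝓘(ℝ, E) X Y x) (Z x)
    + σ x (VectorField.mlieBracket 𝓘(ℝ, E) X Z x) (Y x)
    - σ x (VectorField.mlieBracket 𝓘(ℝ, E) Y Z x) (X x)

/-- `J` is a complex structure: a smooth field of endomorphisms with `J² = -1` whose Nijenhuis
tensor vanishes (integrability). -/
structure IsComplexStructure [IsManifold 𝓘(ℝ, E) ∞ M]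
    (J : ∀ x : M, TangentSpace 𝓘(ℝ, E) x →L[ℝ] TangentSpace 𝓘(ℝ, E) x) : Prop where
  smooth : IsSmoothEndo J
  sq_eq_neg : ∀ (x : M) (v : TangentSpace 𝓘(ℝ, E) x), J x (J x v) = -v
  integrable : ∀ (x : M) (X Y : ∀ x : M, TangentSpace 𝓘(ℝ, E) x), SmoothAt X x → SmoothAt Y x →
    VectorField.mlieBracket 𝓘(ℝ, E) (fun y ↦ J y (X y)) (fun y ↦ J y (Y y)) x
      - J x (VectorField.mlieBracket 𝓘(ℝ, E) (fun y ↦ J y (X y)) Y x)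
      - J x (VectorField.mlieBracket 𝓘(ℝ, E) X (fun y ↦ J y (Y y)) x)
      - VectorField.mlieBracket 𝓘(ℝ, E) X Y x = 0

variable (E M) in
/-- Smooth Riemannian metrics on `M`. -/
abbrev Metric [IsManifold 𝓘(ℝ, E) ∞ M] : Type _ :=
  Bundle.ContMDiffRiemannianMetric 𝓘(ℝ, E) ∞ E (fun x : M ↦ TangentSpace 𝓘(ℝ, E) x)

variable [IsManifold 𝓘(ℝ, E) ∞ M]

/-- The metric `g` is Hermitian: `g(Jv, Jw) = g(v, w)`. -/
def IsHermitian (J : ∀ x : M, TangentSpace 𝓘(ℝ, E) x →L[ℝ] TangentSpace 𝓘(ℝ, E) x)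
    (g : Metric E M) : Prop :=
  ∀ (x : M) (v w : TangentSpace 𝓘(ℝ, E) x), g.inner x (J x v) (J x w) = g.inner x v w

/-- The fundamental two-form `ω(v, w) = g(Jv, w)`. -/
def fundamentalForm (J : ∀ x : M, TangentSpace 𝓘(ℝ, E) x →L[ℝ] TangentSpace 𝓘(ℝ, E) x)
    (g : Metric E M) (x : M) (v w : TangentSpace 𝓘(ℝ, E) x) : ℝ :=
  g.inner x (J x v) w

/-- `θ` is a Lee form of the Hermitian metric `g`: a smooth one-form with `dθ = 0` and
`dω = θ ∧ ω`. -/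
structure IsLeeForm (J : ∀ x : M, TangentSpace 𝓘(ℝ, E) x →L[ℝ] TangentSpace 𝓘(ℝ, E) x)
    (g : Metric E M) (θ : ∀ x : M, TangentSpace 𝓘(ℝ, E) x →L[ℝ] ℝ) : Prop where
  smooth : IsSmoothForm θ
  closed : ∀ (x : M) (X Y : ∀ x : M, TangentSpace 𝓘(ℝ, E) x), SmoothAt X x → SmoothAt Y x →
    extDeriv₁ θ X Y x = 0
  extDeriv_eq : ∀ (x : M) (X Y Z : ∀ x : M, TangentSpace 𝓘(ℝ, E) x),
    SmoothAt X x → SmoothAt Y x → SmoothAt Z x →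
    extDeriv₂ (fundamentalForm J g) X Y Z x =
      θ x (X x) * fundamentalForm J g x (Y x) (Z x)
        - θ x (Y x) * fundamentalForm J g x (X x) (Z x)
        + θ x (Z x) * fundamentalForm J g x (X x) (Y x)

/-- The twisted differential `d_θ f = df - f θ` of a function. -/
def twistedDeriv₀ (θ : ∀ x : M, TangentSpace 𝓘(ℝ, E) x →L[ℝ] ℝ) (f : M → ℝ) (x : M) :
    TangentSpace 𝓘(ℝ, E) x →L[ℝ] ℝ :=
  mvfderiv 𝓘(ℝ, E) f x - f x • θ x

/-- The twisted differential `d_θ β = dβ - θ ∧ β` of a one-form, at `x`, on vector fields. -/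
def twistedDeriv₁ (θ β : ∀ x : M, TangentSpace 𝓘(ℝ, E) x →L[ℝ] ℝ)
    (X Y : ∀ x : M, TangentSpace 𝓘(ℝ, E) x) (x : M) : ℝ :=
  extDeriv₁ β X Y x - (θ x (X x) * β x (Y x) - θ x (Y x) * β x (X x))

/-- The action of `J` on one-forms, `(Jα)(v) = -α(Jv)`. -/
def actForm (J : ∀ x : M, TangentSpace 𝓘(ℝ, E) x →L[ℝ] TangentSpace 𝓘(ℝ, E) x)
    (α : ∀ x : M, TangentSpace 𝓘(ℝ, E) x →L[ℝ] ℝ) (x : M) : TangentSpace 𝓘(ℝ, E) x →L[ℝ] ℝ :=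
  -(α x).comp (J x)

/-- `g` is an lcK metric with potential: it is Hermitian, has a Lee form `θ`, and there is a
smooth function `f : M → ℝ` with `ω = d_θ J d_θ f`. -/
def IsLcKWithPotential (J : ∀ x : M, TangentSpace 𝓘(ℝ, E) x →L[ℝ] TangentSpace 𝓘(ℝ, E) x)
    (g : Metric E M) : Prop :=
  IsHermitian J g ∧
    ∃ θ : ∀ x : M, TangentSpace 𝓘(ℝ, E) x →L[ℝ] ℝ, IsLeeForm J g θ ∧
    ∃ f : M → ℝ, ContMDiff 𝓘(ℝ, E) 𝓘(ℝ, ℝ) ∞ f ∧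
      ∀ (x : M) (X Y : ∀ x : M, TangentSpace 𝓘(ℝ, E) x), SmoothAt X x → SmoothAt Y x →
        fundamentalForm J g x (X x) (Y x) =
          twistedDeriv₁ θ (actForm J (twistedDeriv₀ θ f)) X Y x

/-- `D` is the Levi-Civita connection of `g`: it is torsion-free and metric. In Mathlib's
notation, `D Y x v` is the derivative of `Y` in the direction `v` at `x`. -/
structure IsLeviCivita (g : Metric E M)
    (D : CovariantDerivative 𝓘(ℝ, E) E (fun x : M ↦ TangentSpace 𝓘(ℝ, E) x)) : Prop where
  torsion_free : ∀ (x : M) (X Y : ∀ x : M, TangentSpace 𝓘(ℝ, E) x), DiffAt X x → DiffAt Y x →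
    D Y x (X x) - D X x (Y x) = VectorField.mlieBracket 𝓘(ℝ, E) X Y x
  metric : ∀ (x : M) (v : TangentSpace 𝓘(ℝ, E) x) (Y Z : ∀ x : M, TangentSpace 𝓘(ℝ, E) x),
    DiffAt Y x → DiffAt Z x →
    mvfderiv 𝓘(ℝ, E) (fun y ↦ g.inner y (Y y) (Z y)) x v =
      g.inner x (D Y x v) (Z x) + g.inner x (Y x) (D Z x v)

/-- `θ` is parallel for the Levi-Civita connection `D` of `g`:
`(D_v θ)(Y) = v(θ(Y)) - θ(D_v Y) = 0`. -/
def IsParallel (g : Metric E M) (θ : ∀ x : M, TangentSpace 𝓘(ℝ, E) x →L[ℝ] ℝ) : Prop :=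
  ∃ D : CovariantDerivative 𝓘(ℝ, E) E (fun x : M ↦ TangentSpace 𝓘(ℝ, E) x),
    IsLeviCivita g D ∧
    ∀ (x : M) (v : TangentSpace 𝓘(ℝ, E) x) (Y : ∀ x : M, TangentSpace 𝓘(ℝ, E) x), DiffAt Y x →
      mvfderiv 𝓘(ℝ, E) (fun y ↦ θ y (Y y)) x v = θ x (D Y x v)

/-- `g` is a Vaisman metric: it is Hermitian and has a Lee form that is parallel for the
Levi-Civita connection. (In real dimension at least four the Lee form is unique.) -/
def IsVaisman (J : ∀ x : M, TangentSpace 𝓘(ℝ, E) x →L[ℝ] TangentSpace 𝓘(ℝ, E) x)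
    (g : Metric E M) : Prop :=
  IsHermitian J g ∧
    ∃ θ : ∀ x : M, TangentSpace 𝓘(ℝ, E) x →L[ℝ] ℝ, IsLeeForm J g θ ∧ IsParallel g θ

end Geometry

/-! ### Left-invariant tensors on `Γ \ G`

A tensor on `Γ \ G` is left-invariant if its pull-back to `G` is invariant under all left
translations. -/

section LeftInvariant

variable {E : Type*} [NormedAddCommGroup E] [NormedSpace ℝ E]
  {G : Type*} [TopologicalSpace G] [ChartedSpace E G] [Group G] [LieGroup 𝓘(ℝ, E) ∞ G]

/-- The pull-back `𝒥` of `J` to `G` (the field that is related to `J` by the differential of the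
projection) commutes with the differentials of the left translations. -/
def IsLeftInvariantEndo (Γ : Subgroup G) [DiscreteTopology Γ]
    (J : ∀ x : LeftQuotient Γ, TangentSpace 𝓘(ℝ, E) x →L[ℝ] TangentSpace 𝓘(ℝ, E) x) : Prop :=
  ∃ 𝒥 : ∀ x : G, TangentSpace 𝓘(ℝ, E) x →L[ℝ] TangentSpace 𝓘(ℝ, E) x,
    (∀ (x : G) (v : TangentSpace 𝓘(ℝ, E) x),
      mfderiv 𝓘(ℝ, E) 𝓘(ℝ, E) (proj Γ) x (𝒥 x v) =
        J (proj Γ x) (mfderiv 𝓘(ℝ, E) 𝓘(ℝ, E) (proj Γ) x v)) ∧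
    ∀ (a x : G) (v : TangentSpace 𝓘(ℝ, E) x),
      mfderiv 𝓘(ℝ, E) 𝓘(ℝ, E) (fun y ↦ a * y) x (𝒥 x v) =
        𝒥 (a * x) (mfderiv 𝓘(ℝ, E) 𝓘(ℝ, E) (fun y ↦ a * y) x v)

/-- The pull-back to `G` of the metric `g`. -/
def pullbackMetric (Γ : Subgroup G) [DiscreteTopology Γ] (g : Metric E (LeftQuotient Γ)) (x : G)
    (v w : TangentSpace 𝓘(ℝ, E) x) : ℝ :=
  g.inner (proj Γ x) (mfderiv 𝓘(ℝ, E) 𝓘(ℝ, E) (proj Γ) x v)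
    (mfderiv 𝓘(ℝ, E) 𝓘(ℝ, E) (proj Γ) x w)

/-- The pull-back of `g` to `G` is a left-invariant metric. -/
def IsLeftInvariantMetric (Γ : Subgroup G) [DiscreteTopology Γ]
    (g : Metric E (LeftQuotient Γ)) : Prop :=
  ∀ (a x : G) (v w : TangentSpace 𝓘(ℝ, E) x),
    pullbackMetric Γ g (a * x) (mfderiv 𝓘(ℝ, E) 𝓘(ℝ, E) (fun y ↦ a * y) x v)
      (mfderiv 𝓘(ℝ, E) 𝓘(ℝ, E) (fun y ↦ a * y) x w) = pullbackMetric Γ g x v w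

end LeftInvariant

end LcK

end

noncomputable section

namespace LcK

/-! ### Lie algebras with a Hermitian structure -/

section Algebra

variable {V : Type*} [AddCommGroup V] [Module ℝ V]

/-! The left-invariant fields descend to a global frame of `Γ \ G` that represents the Lie algebra
of `G`. In this frame `J` and `g` have constant coefficients, so the theorem reduces to an algebraic
statement, once `θ` and the potential `f` are made invariant too.

The Lee form is already invariant in real dimension above two: `dω` has constant coefficients, and
`θ ∧ ω` determines `θ` at each point (`eq_zero_of_wedge_eq_zero`). In dimension at most two, `θ ∧ ω`
vanishes and the zero form is a parallel Lee form. The potential is averaged. A discrete cocompact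
subgroup makes `G` unimodular and gives a probability measure on the quotient for which derivatives
along the frame have mean zero (`trace_ad_eq_zero_and_exists_measure`). Integrating `ω = d_θ J d_θ
f` over frame fields replaces `f` by its mean `c`, so `ω = c d_θ η` with `η = θ ∘ J`
(`integral_potential`).

The algebraic core is `ad_skew_of_potential`. Let `A` be the metric dual of `θ`, `D = ad A` and `D'
= ad (J A)`. Contracting `dω = θ ∧ ω` with `A` shows that `D` rescales `ω`. Since the trace of `D`
is zero the factor vanishes, so `D` preserves `ω` infinitesimally and `c θ(A) = 1`. Then `η` kills
the images of `D` and `D'`, which forces `[A, J A] = 0`, hence `D D' = D' D`. For `E = D J - J D`,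
integrability reads `D' J - J D' = J E`. Cyclicity of the trace then gives `tr (E D') = 0` and `tr
(E²) = -2 tr (E D') = 0`. But `E` is symmetric because `D` preserves `ω`, so `E = 0`. Thus `D`
commutes with `J` and is skew for the metric. Together with the closedness of `θ`, the Koszul
formula turns this into `∇θ = 0` (`isParallel_of_ad_skew`). -/

theorem exists_orthonormal_basis [FiniteDimensional ℝ V] (B : V →ₗ[ℝ] V →ₗ[ℝ] ℝ) (hsymm : ∀ x y, B x y = B y x)
    (hpos : ∀ x, x ≠ 0 → 0 < B x x) :
    ∃ b : Module.Basis (Fin (Module.finrank ℝ V)) ℝ V,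
      ∀ i j, B (b i) (b j) = if i = j then 1 else 0 := by
  let core : InnerProductSpace.Core ℝ V :=
    { inner := fun x y ↦ B x y
      conj_inner_symm := fun x y ↦ by simp [hsymm y x]
      re_inner_nonneg := fun x ↦ by
        rcases eq_or_ne x 0 with rfl | hx
        · simp
        · simpa using (hpos x hx).le
      add_left := fun x y z ↦ by simp
      smul_left := fun x y r ↦ by simp
      definite := fun x hx ↦ by
        by_contra h
        exact (hpos x h).ne' hx }
  let : NormedAddCommGroup V := core.toNormedAddCommGroup
  let : InnerProductSpace ℝ V := InnerProductSpace.ofCore core.toCore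
  refine ⟨(stdOrthonormalBasis ℝ V).toBasis, fun i j ↦ ?_⟩
  have := (orthonormal_iff_ite.1 (stdOrthonormalBasis ℝ V).orthonormal) i j
  rw [OrthonormalBasis.coe_toBasis]
  exact this

theorem repr_eq_of_orthonormal {ι : Type*} [Fintype ι] [DecidableEq ι]
    {B : V →ₗ[ℝ] V →ₗ[ℝ] ℝ} {b : Module.Basis ι ℝ V}
    (hb : ∀ i j, B (b i) (b j) = if i = j then 1 else 0) (x : V) (i : ι) :
    b.repr x i = B (b i) x := by
  conv_rhs => rw [← b.sum_repr x, map_sum]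
  simp only [map_smul, hb, smul_eq_mul]
  simp

theorem trace_eq_sum_of_orthonormal {ι : Type*} [Fintype ι] [DecidableEq ι]
    {B : V →ₗ[ℝ] V →ₗ[ℝ] ℝ} {b : Module.Basis ι ℝ V}
    (hb : ∀ i j, B (b i) (b j) = if i = j then 1 else 0) (T : V →ₗ[ℝ] V) :
    LinearMap.trace ℝ V T = ∑ i, B (b i) (T (b i)) := by
  rw [LinearMap.trace_eq_matrix_trace ℝ b, Matrix.trace]
  refine Finset.sum_congr rfl fun i _ ↦ ?_
  rw [Matrix.diag_apply, LinearMap.toMatrix_apply, repr_eq_of_orthonormal hb]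

end Algebra

/-! ### The algebraic core: the adjoint action of the Lee vector is skew. -/

section LieAlgebra

variable {L : Type*} [LieRing L] [LieAlgebra ℝ L] [FiniteDimensional ℝ L]

/-- Let `L` be a unimodular Lie algebra with a complex structure `J`, a Hermitian inner product `B`
and a closed one-form `θ` such that `dω = θ ∧ ω` and `ω` is a multiple of `d_θ (Jθ)`. Then the
adjoint endomorphism of the metric dual of `θ` is skew-symmetric. -/
theorem ad_skew_of_potential (J : L →ₗ[ℝ] L) (hJ : ∀ x, J (J x) = -x)
    (hint : ∀ x y : L, ⁅J x, J y⁆ - J ⁅J x, y⁆ - J ⁅x, J y⁆ - ⁅x, y⁆ = 0)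
    (B : L →ₗ[ℝ] L →ₗ[ℝ] ℝ) (hsymm : ∀ x y, B x y = B y x) (hpos : ∀ x, x ≠ 0 → 0 < B x x)
    (hherm : ∀ x y, B (J x) (J y) = B x y)
    (htr : ∀ x, LinearMap.trace ℝ L (LieAlgebra.ad ℝ L x : L →ₗ[ℝ] L) = 0)
    (θ : L →ₗ[ℝ] ℝ) (hθ : ∀ x y : L, θ ⁅x, y⁆ = 0) (c : ℝ)
    (hpot : ∀ x y : L, B (J x) y = -c * θ (J ⁅x, y⁆) - c * (θ x * θ (J y) - θ y * θ (J x)))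
    (hω : ∀ x y z : L, -B (J ⁅x, y⁆) z + B (J ⁅x, z⁆) y - B (J ⁅y, z⁆) x =
      θ x * B (J y) z - θ y * B (J x) z + θ z * B (J x) y)
    (A : L) (hA : ∀ y, B A y = θ y) (x y : L) : B ⁅A, x⁆ y + B x ⁅A, y⁆ = 0 := by
  classical
  have hnd : ∀ x, (∀ y, B x y = 0) → x = 0 := fun x h ↦ by
    by_contra hx
    exact (hpos x hx).ne' (h x)
  have hJskew : ∀ x y, B (J x) y = -B x (J y) := fun x y ↦ by
    rw [← hherm (J x) y, hJ]; simp
  have hη : ∀ y, θ (J y) = -B (J A) y := fun y ↦ by rw [← hA, hJskew]; simp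
  have hJinj : ∀ x, J x = 0 → x = 0 := fun x h ↦ by
    have := hJ x
    rw [h] at this
    simpa using this.symm
  rcases eq_or_ne c 0 with rfl | hc
  · have h0 : ∀ x y, B x y = 0 := fun x y ↦ by
      rw [← hherm, hpot]; simp
    simp [h0]
  obtain ⟨b, hb⟩ := exists_orthonormal_basis B hsymm hpos
  rcases Nat.eq_zero_or_pos (Module.finrank ℝ L) with hd | hd
  · have := Module.finrank_zero_iff.1 hd
    rw [Subsingleton.elim ⁅A, x⁆ 0, Subsingleton.elim x 0]; simp
  have hθJA : θ (J A) = 0 := by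
    have h1 := hJskew A A
    rw [hsymm] at h1
    rw [← hA]; linarith
  -- Contract `dω = θ ∧ ω` with `A`. The term `B (J ⁅y, z⁆) A` is `η ⁅y, z⁆`, which the potential
  -- identity expresses through `ω` and `θ ∧ η`; the wedge terms cancel and `ad A` acts on `ω` as an
  -- infinitesimal homothety.
  have hω' : ∀ y z, c * (B (J ⁅A, y⁆) z + B (J y) ⁅A, z⁆) = (1 - c * θ A) * B (J y) z := by
    intro y z
    have h1 := hω A y z
    have h2 := hpot y z
    have h3 : B (J ⁅A, z⁆) y = -B (J y) ⁅A, z⁆ := by rw [hJskew, hsymm]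
    have h4 : B (J ⁅y, z⁆) A = θ (J ⁅y, z⁆) := by rw [hsymm, hA]
    rw [hη y, hη z] at h2
    rw [h3, h4] at h1
    linear_combination (-c) * h1 - h2
  let Jeq : L ≃ₗ[ℝ] L := LinearEquiv.ofLinearMap J (-J) (by ext x; simp [hJ]) (by ext x; simp [hJ])
  have hb' : ∀ i j, B (b.map Jeq i) (b.map Jeq j) = if i = j then 1 else 0 := fun i j ↦ by
    simpa [Jeq, hherm] using hb i j
  -- Put `z = J y` and sum over `y` in an orthonormal basis `b`. The two sums on the left are traces
  -- of `ad A`, computed in `b` and in `J b`, so both vanish; the right side is the dimension times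
  -- the homothety factor.
  have hcn : 1 - c * θ A = 0 := by
    have h1 := htr A
    have h2 := htr A
    rw [trace_eq_sum_of_orthonormal hb] at h1
    rw [trace_eq_sum_of_orthonormal hb'] at h2
    have h3 : ∑ i, c * (B (J ⁅A, b i⁆) (J (b i)) + B (J (b i)) ⁅A, J (b i)⁆) =
        ∑ i : Fin (Module.finrank ℝ L), (1 - c * θ A) := by
      refine Finset.sum_congr rfl fun i _ ↦ ?_
      rw [hω', hherm, hb]; simp
    rw [← Finset.mul_sum, Finset.sum_add_distrib] at h3
    have h4 : ∑ i, B (J ⁅A, b i⁆) (J (b i)) = 0 := by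
      rw [← h1]
      refine Finset.sum_congr rfl fun i _ ↦ ?_
      rw [hherm, hsymm]; rfl
    have h5 : ∑ i, B (J (b i)) ⁅A, J (b i)⁆ = 0 := by
      rw [← h2]
      refine Finset.sum_congr rfl fun i _ ↦ ?_
      simp [Jeq]
    rw [h4, h5] at h3
    simp only [add_zero, mul_zero, Finset.sum_const, Finset.card_univ, Fintype.card_fin,
      nsmul_eq_mul] at h3
    exact (mul_eq_zero.1 h3.symm).resolve_left (by exact_mod_cast hd.ne')
  have hsp : ∀ y z, B (J ⁅A, y⁆) z + B (J y) ⁅A, z⁆ = 0 := fun y z ↦ by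
    have := hω' y z
    rw [hcn, zero_mul] at this
    exact (mul_eq_zero.1 this).resolve_left hc
  -- Insert `A`, and below `J A`, in the potential identity: since `c θ(A) = 1`, everything except
  -- the bracket term cancels.
  have hηA : ∀ y, θ (J ⁅A, y⁆) = 0 := fun y ↦ by
    have h1 := hpot A y
    rw [hθJA] at h1
    have h2 := hη y
    refine (mul_eq_zero.1 ?_).resolve_left hc
    linear_combination h1 - h2 + θ (J y) * hcn
  have hηJA : ∀ y, θ (J ⁅J A, y⁆) = 0 := fun y ↦ by
    have h1 := hpot (J A) y
    rw [hθJA, hJ] at h1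
    have h2 := hA A
    have h3 := hA y
    simp only [map_neg, LinearMap.neg_apply] at h1
    refine (mul_eq_zero.1 ?_).resolve_left hc
    linear_combination h1 + h3 + θ y * hcn
  -- Nondegeneracy of `ω` suffices: in `ω(⁅A, J A⁆, y)` the form `θ` kills brackets, and by the
  -- Jacobi identity `η` only meets elements of the images of `ad A` and `ad (J A)`.
  have hcomm : ⁅A, J A⁆ = 0 := by
    refine hJinj _ (hnd _ fun y ↦ ?_)
    have h1 : ⁅⁅A, J A⁆, y⁆ = ⁅A, ⁅J A, y⁆⁆ - ⁅J A, ⁅A, y⁆⁆ := lie_lie A (J A) y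
    rw [hpot, hθ, hηA, h1, map_sub, map_sub, hηA, hηJA]
    simp
  have hDD : ∀ y : L, ⁅A, ⁅J A, y⁆⁆ = ⁅J A, ⁅A, y⁆⁆ := fun y ↦ by
    rw [leibniz_lie A (J A) y, hcomm]; simp
  let j : Module.End ℝ L := J
  let D : Module.End ℝ L := LieAlgebra.ad ℝ L A
  let D' : Module.End ℝ L := LieAlgebra.ad ℝ L (J A)
  let E : Module.End ℝ L := D * j - j * D
  have hjj : j * j = -1 := LinearMap.ext fun x ↦ by simp [j, hJ]
  have hcom : D * D' = D' * D := LinearMap.ext fun x ↦ hDD x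
  have hE1 : D' * j - j * D' = j * E := LinearMap.ext fun x ↦ by
    have := hint A x
    simp only [D, D', j, E, Module.End.mul_apply, LinearMap.sub_apply, LieAlgebra.ad_apply,
      map_sub, hJ]
    rw [← sub_eq_zero, ← this]
    abel
  have hjj' : ∀ X : Module.End ℝ L, X * j * j = -X := fun X ↦ by rw [mul_assoc, hjj]; simp
  have hjj'' : ∀ X : Module.End ℝ L, j * (j * X) = -X := fun X ↦ by rw [← mul_assoc, hjj]; simp
  have hEj : E * j = -(j * E) := by
    simp only [E, sub_mul, mul_sub, hjj', hjj'']
    rw [mul_assoc]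
    abel
  have hED : LinearMap.trace ℝ L (E * D') = 0 := by
    have h1 : LinearMap.trace ℝ L (D * j * D') = LinearMap.trace ℝ L (j * D' * D) := by
      rw [mul_assoc, LinearMap.trace_mul_comm]
    have h2 : E * D' = D * j * D' - j * D' * D := by
      simp only [E, sub_mul, mul_assoc, hcom]
    rw [h2, map_sub, h1, sub_self]
  -- Since `E` anticommutes with `j`, `E² = E (j E) j`. Substituting `j E = D' j - j D'` gives `-E
  -- D' - E j D' j`, and both terms have trace `-tr (E D') = 0` after a cyclic permutation.
  have hEE : LinearMap.trace ℝ L (E * E) = 0 := by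
    have h1 : E * E = -(E * D') - E * j * (D' * j) := by
      have h2 : E * (j * E) * j = E * E := by
        rw [← neg_eq_iff_eq_neg.2 hEj]
        simp only [mul_neg, neg_mul, ← mul_assoc, hjj', neg_neg]
      rw [← h2, ← hE1]
      simp only [mul_sub, sub_mul, mul_assoc, hjj]
      simp
    have h3 : LinearMap.trace ℝ L (E * j * (D' * j)) = LinearMap.trace ℝ L (E * D') := by
      have h4 : j * (E * j) = E := by
        rw [hEj, mul_neg, hjj'', neg_neg]
      rw [← mul_assoc, LinearMap.trace_mul_comm, ← mul_assoc, h4]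
    rw [h1, map_sub, map_neg, h3, hED]
    simp
  -- Invariance of `ω` at `(x, y)` and at `(J x, J y)`, rewritten through the metric.
  have hEsymm : ∀ x y, B (E x) y = B x (E y) := fun x y ↦ by
    have h1 := hsp (J x) (J y)
    have h2 := hsp x y
    have h3 := hherm ⁅A, J x⁆ y
    simp only [hherm, hJ, map_neg, LinearMap.neg_apply] at h1
    simp only [E, D, j, Module.End.mul_apply, LinearMap.sub_apply, LieAlgebra.ad_apply, map_sub]
    rw [hJskew x] at h2
    linarith
  have hE0 : ∀ x, E x = 0 := by
    rw [trace_eq_sum_of_orthonormal hb] at hEE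
    have h1 : ∑ i, B (E (b i)) (E (b i)) = 0 := by
      rw [← hEE]
      exact Finset.sum_congr rfl fun i _ ↦ hEsymm _ _
    have hnn : ∀ x, 0 ≤ B x x := fun x ↦ by
      rcases eq_or_ne x 0 with rfl | hx
      · simp
      · exact (hpos x hx).le
    have h2 : E = 0 := b.ext fun i ↦ by
      by_contra h
      have h3 := (Finset.sum_eq_zero_iff_of_nonneg fun i _ ↦ hnn _).1 h1 i (Finset.mem_univ i)
      exact (hpos _ h).ne' h3
    simp [h2]
  -- As `D` commutes with `J`, invariance of `ω` at `(-J x, y)` is skewness for `B` at `(x, y)`.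
  have h1 := hsp (-J x) y
  have h2 := hE0 x
  simp only [E, D, j, Module.End.mul_apply, LinearMap.sub_apply, LieAlgebra.ad_apply] at h2
  rw [sub_eq_zero] at h2
  simp only [lie_neg, map_neg, h2, hJ, neg_neg] at h1
  exact h1

end LieAlgebra

/-! ### Discrete cocompact subgroups -/

section Topological

open MeasureTheory Pointwise

variable {G : Type*} [TopologicalSpace G] [Group G] [IsTopologicalGroup G]

/-- The powers of a compact symmetric neighbourhood of `1` fill an open, hence closed, subgroup,
which is everything by connectedness. -/
theorem sigmaCompactSpace_of_connectedSpace [LocallyCompactSpace G] [ConnectedSpace G] :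
    SigmaCompactSpace G := by
  obtain ⟨K, hK, hK1⟩ := exists_compact_mem_nhds (1 : G)
  have hL : IsCompact (K ∪ K⁻¹) := hK.union hK.inv
  set L := K ∪ K⁻¹
  have hpow : ∀ n : ℕ, IsCompact (L ^ n) := fun n ↦ by
    induction n with
    | zero => simp
    | succ n ih => rw [pow_succ]; exact ih.mul hL
  refine ⟨⟨fun n ↦ L ^ n, hpow, ?_⟩⟩
  let H : Subgroup G :=
    { carrier := ⋃ n : ℕ, L ^ n
      one_mem' := Set.mem_iUnion.2 ⟨0, by simp⟩
      mul_mem' := fun {a b} ha hb ↦ by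
        obtain ⟨m, hm⟩ := Set.mem_iUnion.1 ha
        obtain ⟨n, hn⟩ := Set.mem_iUnion.1 hb
        exact Set.mem_iUnion.2 ⟨m + n, by rw [pow_add]; exact Set.mul_mem_mul hm hn⟩
      inv_mem' := fun {a} ha ↦ by
        obtain ⟨m, hm⟩ := Set.mem_iUnion.1 ha
        refine Set.mem_iUnion.2 ⟨m, ?_⟩
        have : L⁻¹ = L := by simp [L, Set.union_comm]
        rw [← this, inv_pow]
        exact Set.inv_mem_inv.2 hm }
  have hH : IsOpen (H : Set G) := by
    refine Subgroup.isOpen_of_mem_nhds H (g := 1) (Filter.mem_of_superset hK1 fun x hx ↦ ?_)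
    exact Set.mem_iUnion.2 ⟨1, by rw [pow_one]; exact Or.inl hx⟩
  exact (IsClopen.eq_univ ⟨Subgroup.isClosed_of_isOpen H hH, hH⟩ ⟨1, H.one_mem⟩ :)

/-- Cover `K` by finitely many translates `A i = U g i`, with `U` so small that `U U⁻¹` meets `Γ`
only in `1`: each orbit then meets each `A i` at most once. Removing from `A i` the saturations of
the earlier `A j` leaves exactly one point per orbit. Because this holds for every orbit and not
just almost every one, right translates of `F` are fundamental domains as well. -/
theorem exists_fundamentalDomain [T2Space G] [LocallyCompactSpace G] [MeasurableSpace G]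
    [BorelSpace G] (Γ : Subgroup G) [DiscreteTopology Γ] {K : Set G} (hK : IsCompact K)
    (hΓK : ∀ x, ∃ γ : Γ, γ • x ∈ K) (μ : Measure G) [IsFiniteMeasureOnCompacts μ] :
    ∃ F : Set G, IsFundamentalDomain Γ F μ ∧ μ F < ⊤ ∧
      ∀ g : G, IsFundamentalDomain Γ ((· * g) ⁻¹' F) μ := by
  classical
  obtain ⟨W, hW, hWΓ⟩ : ∃ W ∈ 𝓝 (1 : G), ∀ x ∈ W, x ∈ Γ → x = 1 := by
    have h1 : ({1} : Set Γ) ∈ 𝓝 (1 : Γ) := by simp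
    obtain ⟨W, hW, hW'⟩ := mem_nhds_induced _ _ _ |>.1 h1
    exact ⟨W, hW, fun x hx hxΓ ↦ congrArg Subtype.val (hW' (a := ⟨x, hxΓ⟩) hx)⟩
  obtain ⟨C, hC, hC1⟩ := exists_compact_mem_nhds (1 : G)
  obtain ⟨V, hV, hVW⟩ := exists_nhds_split_inv hW
  set U := interior (V ∩ C)
  have hU1 : (1 : G) ∈ U := mem_interior_iff_mem_nhds.2 (Filter.inter_mem hV hC1)
  have hUV : ∀ u ∈ U, u ∈ V := fun u hu ↦ (interior_subset hu).1
  have hUC : ∀ u ∈ U, u ∈ C := fun u hu ↦ (interior_subset hu).2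
  obtain ⟨n, g, hg⟩ : ∃ (n : ℕ) (g : Fin n → G), ∀ x ∈ K, ∃ i, x * (g i)⁻¹ ∈ U := by
    obtain ⟨t, -, ht⟩ := hK.elim_nhds_subcover (fun x ↦ {y | y * x⁻¹ ∈ U}) fun x _ ↦ by
      refine (isOpen_interior.preimage (continuous_mul_const x⁻¹)).mem_nhds ?_
      change x * x⁻¹ ∈ U
      rwa [mul_inv_cancel]
    refine ⟨t.card, fun i ↦ t.equivFin.symm i, fun x hx ↦ ?_⟩
    obtain ⟨y, hy, hxy⟩ := Set.mem_iUnion₂.1 (ht hx)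
    exact ⟨t.equivFin ⟨y, hy⟩, by simpa using hxy⟩
  let A : Fin n → Set G := fun i ↦ {y | y * (g i)⁻¹ ∈ U}
  have hA : ∀ i, IsOpen (A i) := fun i ↦ isOpen_interior.preimage (continuous_mul_const _)
  let T : Fin n → Set G := fun i ↦ {y | ∃ γ : Γ, γ • y ∈ A i}
  have hT : ∀ i, IsOpen (T i) := fun i ↦ by
    have : T i = ⋃ γ : Γ, (fun y ↦ (γ : G) * y) ⁻¹' A i := by
      ext y; simp [T, Subgroup.smul_def]
    rw [this]
    exact isOpen_iUnion fun γ ↦ (hA i).preimage (continuous_const_mul _)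
  have hTs : ∀ i (γ : Γ) y, γ • y ∈ T i ↔ y ∈ T i := fun i γ y ↦
    ⟨fun ⟨δ, h⟩ ↦ ⟨δ * γ, by rwa [mul_smul]⟩, fun ⟨δ, h⟩ ↦ ⟨δ * γ⁻¹, by simpa [mul_smul] using h⟩⟩
  let F : Set G := ⋃ i, A i \ ⋃ j ∈ Set.Iio i, T j
  have hFmem : ∀ y, y ∈ F ↔ ∃ i, y ∈ A i ∧ ∀ j < i, y ∉ T j := fun y ↦ by simp [F]
  have hFmeas : MeasurableSet F := MeasurableSet.iUnion fun i ↦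
    (hA i).measurableSet.diff (MeasurableSet.biUnion (Set.to_countable _) fun j _ ↦
      (hT j).measurableSet)
  have hFex : ∀ x, ∃! γ : Γ, γ • x ∈ F := fun x ↦ by
    obtain ⟨γ₀, hγ₀⟩ := hΓK x
    obtain ⟨i₀, hi₀⟩ := hg _ hγ₀
    -- The representative of an orbit lies in the first `A i` that the orbit meets.
    obtain ⟨i, ⟨γ, hγ⟩, hmin⟩ := wellFounded_lt.has_min {i | x ∈ T i} ⟨i₀, γ₀, hi₀⟩
    refine ⟨γ, (hFmem _).2 ⟨i, hγ, fun j hj h ↦ hmin j ((hTs j γ x).1 h) hj⟩, fun δ hδ ↦ ?_⟩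
    obtain ⟨k, hk, hk'⟩ := (hFmem _).1 hδ
    have hki : k = i := by
      refine le_antisymm (not_lt.1 fun h ↦ hk' i h ((hTs i δ x).2 ⟨γ, hγ⟩))
        (not_lt.1 fun h ↦ hmin k ⟨δ, hk⟩ h)
    subst hki
    have h1 := hVW _ (hUV _ hk) _ (hUV _ hγ)
    have h2 : (δ • x) * (g k)⁻¹ / ((γ • x) * (g k)⁻¹) = ((δ * γ⁻¹ : Γ) : G) := by
      simp [Subgroup.smul_def, div_eq_mul_inv, mul_assoc]
    rw [h2] at h1
    have h3 := hWΓ _ h1 (δ * γ⁻¹).2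
    exact mul_inv_eq_one.1 (Subtype.ext h3)
  refine ⟨F, IsFundamentalDomain.mk' hFmeas.nullMeasurableSet hFex, ?_, fun h ↦
    IsFundamentalDomain.mk' ((measurable_mul_const h) hFmeas).nullMeasurableSet fun x ↦ ?_⟩
  · have hFC : F ⊆ ⋃ i, (fun y ↦ y * g i) '' C := fun y hy ↦ by
      obtain ⟨i, hi, -⟩ := (hFmem y).1 hy
      exact Set.mem_iUnion.2 ⟨i, _, hUC _ hi, by simp⟩
    refine (measure_mono hFC).trans_lt (IsCompact.measure_lt_top ?_)
    exact isCompact_iUnion fun i ↦ hC.image (continuous_mul_const _)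
  · simpa [Subgroup.smul_def, mul_assoc] using hFex (x * h)

/-- Right translation scales `μ` by the modular character, yet it carries `F` to a fundamental
domain, and these all have the same measure, here finite and nonzero. -/
theorem isMulRightInvariant_of_fundamentalDomain [LocallyCompactSpace G] [MeasurableSpace G]
    [BorelSpace G] [SecondCountableTopology G] [T2Space G]
    (Γ : Subgroup G) [Countable Γ] (μ : Measure G) [μ.IsHaarMeasure] {F : Set G}
    (hF : IsFundamentalDomain Γ F μ) (hF' : μ F < ⊤)
    (hFg : ∀ g : G, IsFundamentalDomain Γ ((· * g) ⁻¹' F) μ) : μ.IsMulRightInvariant := by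
  refine ⟨fun g ↦ ?_⟩
  have h1 := Measure.map_right_mul_eq_modularCharacterFun_smul μ g
  have h2 : Measure.map (· * g) μ F = μ F := by
    rw [Measure.map_apply₀ (measurable_mul_const g).aemeasurable]
    · exact (hFg g).measure_eq hF
    · rw [h1]; exact hF.nullMeasurableSet.mono_ac (Measure.smul_absolutelyContinuous)
  rw [h1, Measure.smul_apply, ENNReal.smul_def, smul_eq_mul] at h2
  have h3 : μ F ≠ 0 := hF.measure_ne_zero (NeZero.ne μ)
  have h4 : (Measure.modularCharacterFun g : ENNReal) = 1 :=
    (ENNReal.mul_eq_right h3 hF'.ne).1 h2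
  rw [h1, ENNReal.coe_eq_one.1 h4, one_smul]

/-- The substitution replaces `F` by a right translate, over which a `Γ`-invariant function has the
same integral. -/
theorem setIntegral_comp_mul_right [MeasurableSpace G] [BorelSpace G]
    (Γ : Subgroup G) [Countable Γ] (μ : Measure G) [μ.IsMulLeftInvariant] [μ.IsMulRightInvariant]
    {F : Set G} (hF : IsFundamentalDomain Γ F μ)
    (hFg : ∀ g : G, IsFundamentalDomain Γ ((· * g) ⁻¹' F) μ) {f : G → ℝ}
    (hf : ∀ (γ : Γ) x, f (γ • x) = f x) (g : G) :
    ∫ x in F, f (x * g) ∂μ = ∫ x in F, f x ∂μ := by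
  have h1 : ∫ x in (· * g) ⁻¹' F, f (x * g) ∂μ = ∫ x in F, f x ∂μ :=
    (measurePreserving_mul_right μ g).setIntegral_preimage_emb
      (MeasurableEquiv.mulRight g).measurableEmbedding f F
  rw [← h1]
  exact hF.setIntegral_eq (hFg g) fun γ x ↦ by
    simpa [Subgroup.smul_def, mul_assoc] using hf γ (x * g)

end Topological

/-! ### Partial derivatives of smooth maps -/

section Partial

variable {E₁ : Type*} [NormedAddCommGroup E₁] [NormedSpace ℝ E₁] {H₁ : Type*} [TopologicalSpace H₁]
  {I₁ : ModelWithCorners ℝ E₁ H₁} {N₁ : Type*} [TopologicalSpace N₁] [ChartedSpace H₁ N₁]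
  [IsManifold I₁ ∞ N₁]
  {E₂ : Type*} [NormedAddCommGroup E₂] [NormedSpace ℝ E₂] {H₂ : Type*} [TopologicalSpace H₂]
  {I₂ : ModelWithCorners ℝ E₂ H₂} {N₂ : Type*} [TopologicalSpace N₂] [ChartedSpace H₂ N₂]
  [IsManifold I₂ ∞ N₂]
  {E₃ : Type*} [NormedAddCommGroup E₃] [NormedSpace ℝ E₃] {H₃ : Type*} [TopologicalSpace H₃]
  {I₃ : ModelWithCorners ℝ E₃ H₃} {N₃ : Type*} [TopologicalSpace N₃] [ChartedSpace H₃ N₃]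
  [IsManifold I₃ ∞ N₃]

/-- The tangent map of `Φ` is composed with the smooth map `x ↦ ((x, 0), (y, z))` into the product
of the tangent bundles. This is the source of smoothness for invariant fields and for the adjoint
action. -/
theorem contMDiff_partial {Φ : N₁ × N₂ → N₃} (hΦ : ContMDiff (I₁.prod I₂) I₃ ∞ Φ) (y : N₂)
    (z : TangentSpace I₂ y) :
    ContMDiff I₁ I₃.tangent ∞
      (fun x ↦ (⟨Φ (x, y), mfderiv I₂ I₃ (fun y ↦ Φ (x, y)) y z⟩ : TangentBundle I₃ N₃)) := by
  have : IsManifold I₁ 1 N₁ := .of_le (n := ∞) (by simp)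
  have : IsManifold I₂ 1 N₂ := .of_le (n := ∞) (by simp)
  have : IsManifold I₃ 1 N₃ := .of_le (n := ∞) (by simp)
  let s₁ : N₁ → TangentBundle I₁ N₁ := fun x ↦ ⟨x, 0⟩
  have hs₁ : ContMDiff I₁ I₁.tangent ∞ s₁ := Bundle.contMDiff_zeroSection _ _
  let s₂ : N₁ → TangentBundle I₂ N₂ := fun _ ↦ ⟨y, z⟩
  have hs₂ : ContMDiff I₁ I₂.tangent ∞ s₂ := contMDiff_const
  have h1 := (contMDiff_equivTangentBundleProd_symm (n := ∞) (I := I₁) (I' := I₂) (M := N₁)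
    (M' := N₂)).comp (hs₁.prodMk hs₂)
  have h2 := (hΦ.contMDiff_tangentMap (m := ∞) (by simp)).comp h1
  convert! h2 using 2 with x
  simp only [Function.comp_apply, tangentMap, s₁, s₂]
  rw [mfderiv_prod_eq_add_apply (hΦ.mdifferentiable (by simp) _)]
  refine congrArg (fun w ↦ (⟨Φ (x, y), w⟩ : TangentBundle I₃ N₃)) ?_
  change _ = mfderiv I₁ I₃ (fun w ↦ Φ (w, y)) x 0 + mfderiv I₂ I₃ (fun w ↦ Φ (x, w)) y z
  rw [map_zero, zero_add]

end Partial

section Curve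

variable {E : Type*} [NormedAddCommGroup E] [NormedSpace ℝ E]
  {N : Type*} [TopologicalSpace N] [ChartedSpace E N] [IsManifold 𝓘(ℝ, E) ∞ N]

theorem contMDiff_partial_real {H : ℝ × N → ℝ} (hH : ContMDiff (𝓘(ℝ, ℝ).prod 𝓘(ℝ, E)) 𝓘(ℝ, ℝ) ∞ H) :
    ContMDiff (𝓘(ℝ, ℝ).prod 𝓘(ℝ, E)) 𝓘(ℝ, ℝ) ∞
      (fun p : ℝ × N ↦ deriv (fun t ↦ H (t, p.2)) p.1) := by
  -- The shift turns the derivative at the moving time `p.1` into one at the fixed point `0`, as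
  -- `contMDiff_partial` requires.
  let Φ : (ℝ × N) × ℝ → ℝ := fun q ↦ H (q.1.1 + q.2, q.1.2)
  have hΦ : ContMDiff ((𝓘(ℝ, ℝ).prod 𝓘(ℝ, E)).prod 𝓘(ℝ, ℝ)) 𝓘(ℝ, ℝ) ∞ Φ := by
    refine hH.comp (ContMDiff.prodMk ?_ contMDiff_fst.snd)
    exact (contMDiff_fst.fst).add contMDiff_snd
  have h1 := (contMDiff_snd_tangentBundle_modelSpace (n := ∞) ℝ 𝓘(ℝ, ℝ)).comp
    (contMDiff_partial hΦ (0 : ℝ) (1 : ℝ))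
  convert! h1 using 2 with p
  change _ = mfderiv 𝓘(ℝ, ℝ) 𝓘(ℝ, ℝ) (fun y ↦ H (p.1 + y, p.2)) 0 (1 : ℝ)
  rw [mfderiv_eq_fderiv]
  have := deriv_comp_const_add (fun t ↦ H (t, p.2)) p.1 0
  rw [add_zero] at this
  rw [← this]
  rfl

/-- A substitute for one-parameter subgroups: only the velocity at `0` matters, and only up to a
nonzero factor `δ`. -/
theorem exists_curve [FiniteDimensional ℝ E] (x : N) (v : TangentSpace 𝓘(ℝ, E) x) :
    ∃ (a : ℝ → N) (δ : ℝ), ContMDiff 𝓘(ℝ, ℝ) 𝓘(ℝ, E) ∞ a ∧ δ ≠ 0 ∧ a 0 = x ∧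
      ∀ u : N → ℝ, MDifferentiableAt 𝓘(ℝ, E) 𝓘(ℝ, ℝ) u x →
        HasDerivAt (u ∘ a) (δ * mvfderiv 𝓘(ℝ, E) u x v) 0 := by
  have : IsManifold 𝓘(ℝ, E) 1 N := .of_le (n := ∞) (by simp)
  set φ := extChartAt 𝓘(ℝ, E) x
  let w : E := v
  obtain ⟨r, hr, hball⟩ := Metric.isOpen_iff.1 (isOpen_extChartAt_target (I := 𝓘(ℝ, E)) x) (φ x)
    (mem_extChartAt_target x)
  obtain ⟨δ, hδ, hδw⟩ : ∃ δ : ℝ, 0 < δ ∧ δ * ‖w‖ < r := by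
    refine ⟨r / (‖w‖ + 1), by positivity, ?_⟩
    rw [div_mul_eq_mul_div, div_lt_iff₀ (by positivity)]
    nlinarith [norm_nonneg w]
  -- The bounded function `sin` keeps the curve inside the chart for all `t`, so that it is globally
  -- smooth; `δ` is small enough for the ball of radius `r`.
  let p : ℝ → E := fun t ↦ φ x + (δ * Real.sin t) • w
  have hp : ∀ t, p t ∈ φ.target := fun t ↦ hball (by
    rw [Metric.mem_ball, dist_eq_norm]
    simp only [p, add_sub_cancel_left, norm_smul, norm_mul, Real.norm_eq_abs, abs_of_pos hδ]
    have := Real.abs_sin_le_one t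
    have h2 : δ * |Real.sin t| ≤ δ := by nlinarith
    nlinarith [norm_nonneg w])
  have hps : ContDiff ℝ ∞ p := by fun_prop
  have hp0 : p 0 = φ x := by simp [p]
  have ha0 : φ.symm (p 0) = x := by rw [hp0]; exact extChartAt_to_inv x
  have hpd : HasDerivAt p (δ • w) 0 := by
    have h1 : HasDerivAt (fun t ↦ δ * Real.sin t) δ 0 := by
      simpa using (Real.hasDerivAt_sin 0).const_mul δ
    exact (h1.smul_const w).const_add _
  have hsm : ContMDiff 𝓘(ℝ, ℝ) 𝓘(ℝ, E) ∞ (fun t ↦ φ.symm (p t)) := fun t ↦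
    ((contMDiffOn_extChartAt_symm (I := 𝓘(ℝ, E)) (n := ∞) x).contMDiffAt
      ((isOpen_extChartAt_target x).mem_nhds (hp t))).comp t hps.contMDiff.contMDiffAt
  refine ⟨fun t ↦ φ.symm (p t), δ, hsm, hδ.ne', ha0, fun u hu ↦ ?_⟩
  have h1 : MDifferentiableAt 𝓘(ℝ, E) 𝓘(ℝ, E) φ.symm (φ x) :=
    ((contMDiffOn_extChartAt_symm (I := 𝓘(ℝ, E)) (n := ∞) x).contMDiffAt
      ((isOpen_extChartAt_target x).mem_nhds (mem_extChartAt_target x))).mdifferentiableAt (by simp)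
  have h2 : mfderiv 𝓘(ℝ, E) 𝓘(ℝ, E) φ.symm (φ x) = ContinuousLinearMap.id ℝ E := by
    have := mfderivWithin_range_extChartAt_symm (I := 𝓘(ℝ, E)) (x := x)
    rw [ModelWithCorners.range_eq_univ, mfderivWithin_univ] at this
    exact this
  have h3 : HasMFDerivAt 𝓘(ℝ, E) 𝓘(ℝ, ℝ) (u ∘ φ.symm) (φ x) (mfderiv 𝓘(ℝ, E) 𝓘(ℝ, ℝ) u x) := by
    have h4 : φ.symm (φ x) = x := extChartAt_to_inv x
    have h5 := HasMFDerivAt.comp (φ x) (g := u) (by rw [h4]; exact hu.hasMFDerivAt) h1.hasMFDerivAt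
    rw [h2] at h5
    convert! h5 using 1
  have h4 : HasFDerivAt (u ∘ φ.symm) (mvfderiv 𝓘(ℝ, E) u x) (p 0) := by
    rw [hp0]; exact h3.hasFDerivAt
  have h5 := h4.comp_hasDerivAt (0 : ℝ) hpd
  exact h5.congr_deriv ((mvfderiv 𝓘(ℝ, E) u x).map_smul δ v)

end Curve

/-! ### Differentiation under the integral sign -/

section Integral

open MeasureTheory

variable {E : Type*} [NormedAddCommGroup E] [NormedSpace ℝ E]
  {N : Type*} [TopologicalSpace N] [ChartedSpace E N] [IsManifold 𝓘(ℝ, E) ∞ N]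
  [MeasurableSpace N] [BorelSpace N]

theorem integral_deriv_eq_zero {H : ℝ × N → ℝ}
    (hH : ContMDiff (𝓘(ℝ, ℝ).prod 𝓘(ℝ, E)) 𝓘(ℝ, ℝ) ∞ H) (ν : Measure N) {bd : N → ℝ}
    (hbd : Integrable bd ν)
    (hle : ∀ x, ∀ t ∈ Metric.ball (0 : ℝ) 1, |deriv (fun t ↦ H (t, x)) t| ≤ bd x)
    (hint : Integrable (fun x ↦ H (0, x)) ν)
    (hconst : ∀ t, ∫ x, H (t, x) ∂ν = ∫ x, H (0, x) ∂ν) :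
    ∫ x, deriv (fun t ↦ H (t, x)) 0 ∂ν = 0 := by
  have hc : Continuous H := hH.continuous
  have hd : Continuous (fun p : ℝ × N ↦ deriv (fun t ↦ H (t, p.2)) p.1) :=
    (contMDiff_partial_real hH).continuous
  have h1 := (hasDerivAt_integral_of_dominated_loc_of_deriv_le (μ := ν) (bound := bd)
    (F := fun t x ↦ H (t, x)) (F' := fun t x ↦ deriv (fun t ↦ H (t, x)) t) (x₀ := (0 : ℝ))
    (Metric.ball_mem_nhds 0 one_pos)
    (Filter.Eventually.of_forall fun t ↦
      (hc.comp (Continuous.prodMk_right t)).measurable.aestronglyMeasurable)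
    hint (hd.comp (Continuous.prodMk_right 0)).measurable.aestronglyMeasurable
    (Filter.Eventually.of_forall fun x t ht ↦ hle x t ht) hbd
    (Filter.Eventually.of_forall fun x t _ ↦ by
      have h2 : ContMDiff 𝓘(ℝ, ℝ) 𝓘(ℝ, ℝ) ∞ (fun t ↦ H (t, x)) :=
        hH.comp (contMDiff_id.prodMk contMDiff_const)
      exact (h2.contDiff.differentiable (by simp) t).hasDerivAt)).2
  simp only [hconst] at h1
  exact h1.unique (hasDerivAt_const _ _)

/-- The integral of the derivative of a compactly supported function along a measure-preserving
family of transformations vanishes. -/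
theorem integral_deriv_eq_zero_of_hasCompactSupport [T2Space N] {Φ Ψ : ℝ × N → N}
    (hΦ : ContMDiff (𝓘(ℝ, ℝ).prod 𝓘(ℝ, E)) 𝓘(ℝ, E) ∞ Φ) (hΨ : Continuous Ψ)
    (hΨΦ : ∀ t x, Ψ (t, Φ (t, x)) = x) (ν : Measure N) [IsFiniteMeasureOnCompacts ν]
    {u : N → ℝ} (hu : ContMDiff 𝓘(ℝ, E) 𝓘(ℝ, ℝ) ∞ u) (hu' : HasCompactSupport u)
    (hconst : ∀ t, ∫ x, u (Φ (t, x)) ∂ν = ∫ x, u x ∂ν) :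
    ∫ x, deriv (fun t ↦ u (Φ (t, x))) 0 ∂ν = 0 := by
  have hH : ContMDiff (𝓘(ℝ, ℝ).prod 𝓘(ℝ, E)) 𝓘(ℝ, ℝ) ∞ (fun p ↦ u (Φ p)) := hu.comp hΦ
  have hd := (contMDiff_partial_real hH).continuous
  have hI : IsCompact (Set.Icc (-1 : ℝ) 1) := isCompact_Icc
  -- `Ψ` recovers `x` from `Φ (t, x)`, so for `|t| ≤ 1` all the functions `u (Φ (t, ·))` are
  -- supported in this one compact set, which yields an integrable bound.
  set K : Set N := Ψ '' (Set.Icc (-1 : ℝ) 1 ×ˢ tsupport u)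
  have hK : IsCompact K := (hI.prod hu').image hΨ
  have h0 : ∀ t ∈ Set.Icc (-1 : ℝ) 1, ∀ x ∉ K, u (Φ (t, x)) = 0 := fun t ht x hx ↦ by
    by_contra h
    exact hx ⟨(t, Φ (t, x)), ⟨ht, subset_tsupport _ h⟩, hΨΦ t x⟩
  obtain ⟨C, hC⟩ := (hI.prod hK).exists_bound_of_continuousOn hd.continuousOn
  refine integral_deriv_eq_zero hH ν (bd := K.indicator fun _ ↦ C) ?_ (fun x t ht ↦ ?_) ?_
    fun t ↦ (hconst t).trans (hconst 0).symm
  · exact (integrable_indicator_iff hK.measurableSet).2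
      (integrableOn_const hK.measure_lt_top.ne)
  · rw [Real.ball_eq_Ioo] at ht
    have ht' : t ∈ Set.Ioo (-1 : ℝ) 1 := by simpa using ht
    by_cases hx : x ∈ K
    · rw [Set.indicator_of_mem hx]
      exact hC (t, x) ⟨Set.Ioo_subset_Icc_self ht', hx⟩
    · rw [Set.indicator_of_notMem hx]
      have : (fun t ↦ u (Φ (t, x))) =ᶠ[𝓝 t] fun _ ↦ 0 := by
        filter_upwards [isOpen_Ioo.mem_nhds ht'] with s hs
        exact h0 s (Set.Ioo_subset_Icc_self hs) x hx
      rw [this.deriv_eq]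
      simp
  · refine Continuous.integrable_of_hasCompactSupport
      (hH.continuous.comp (Continuous.prodMk_right 0)) ?_
    exact HasCompactSupport.of_support_subset_isCompact hK fun x hx ↦ by
      by_contra h
      exact hx (h0 0 (by simp) x h)

end Integral

/-! ### Invariant vector fields on a Lie group -/

section LieGroup

open MeasureTheory VectorField

variable {E : Type*} [NormedAddCommGroup E] [NormedSpace ℝ E]
  {G : Type*} [TopologicalSpace G] [ChartedSpace E G]

theorem tangentBundle_mk_congr {x y : G} (h : x = y) (w : E) :
    (⟨x, w⟩ : TangentBundle 𝓘(ℝ, E) G) = ⟨y, w⟩ := by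
  subst h; rfl

theorem contMDiff_mvfderiv_apply [IsManifold 𝓘(ℝ, E) ∞ G] {u : G → ℝ}
    (hu : ContMDiff 𝓘(ℝ, E) 𝓘(ℝ, ℝ) ∞ u) {X : ∀ x : G, TangentSpace 𝓘(ℝ, E) x}
    (hX : ∀ x, SmoothAt X x) :
    ContMDiff 𝓘(ℝ, E) 𝓘(ℝ, ℝ) ∞ (fun x ↦ mvfderiv 𝓘(ℝ, E) u x (X x)) := by
  have : IsManifold 𝓘(ℝ, E) 1 G := .of_le (n := ∞) (by simp)
  exact (contMDiff_snd_tangentBundle_modelSpace (n := ∞) ℝ 𝓘(ℝ, ℝ)).comp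
    ((hu.contMDiff_tangentMap (m := ∞) (by simp)).comp (fun x ↦ hX x))

theorem SmoothAt.diffAt [IsManifold 𝓘(ℝ, E) ∞ G] {X : ∀ x : G, TangentSpace 𝓘(ℝ, E) x} {x : G}
    (hX : SmoothAt X x) : DiffAt X x :=
  ContMDiffAt.mdifferentiableAt hX (by simp)

variable [Group G]

/-- The value of `Ad(x⁻¹)` at `z`. -/
def adInv (z : GroupLieAlgebra 𝓘(ℝ, E) G) (x : G) : E :=
  mfderiv 𝓘(ℝ, E) 𝓘(ℝ, E) (fun y ↦ x⁻¹ * y * x) (1 : G) z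

theorem adInv_one (z : GroupLieAlgebra 𝓘(ℝ, E) G) : adInv z (1 : G) = z := by
  have : (fun y : G ↦ (1 : G)⁻¹ * y * 1) = id := by ext; simp
  rw [adInv, this, mfderiv_id]
  rfl

variable [LieGroup 𝓘(ℝ, E) ∞ G]

instance : LieGroup 𝓘(ℝ, E) (minSmoothness ℝ 3) G := by
  rw [minSmoothness_of_isRCLikeNormedField]
  infer_instance

instance : IsManifold 𝓘(ℝ, E) (minSmoothness ℝ 3) G := by
  rw [minSmoothness_of_isRCLikeNormedField]
  infer_instance

theorem smoothAt_mulInvariantVectorField (v : GroupLieAlgebra 𝓘(ℝ, E) G) (x : G) :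
    SmoothAt (mulInvariantVectorField v) x := by
  have h := contMDiff_partial (I₁ := 𝓘(ℝ, E)) (I₂ := 𝓘(ℝ, E)) (I₃ := 𝓘(ℝ, E))
    (Φ := fun p : G × G ↦ p.1 * p.2) (contMDiff_mul 𝓘(ℝ, E) ∞) 1 v
  have h2 : ∀ x : G, (⟨x * 1, mfderiv 𝓘(ℝ, E) 𝓘(ℝ, E) (fun y ↦ x * y) 1 v⟩ :
      TangentBundle 𝓘(ℝ, E) G) = ⟨x, mulInvariantVectorField v x⟩ := fun x ↦
    tangentBundle_mk_congr (mul_one x) _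
  simp only [h2] at h
  exact h x

/-- The right-invariant vector field with value `z` at `1`. -/
def rightField (z : GroupLieAlgebra 𝓘(ℝ, E) G) (x : G) : TangentSpace 𝓘(ℝ, E) x :=
  mfderiv 𝓘(ℝ, E) 𝓘(ℝ, E) (fun y ↦ y * x) (1 : G) z

theorem smoothAt_rightField (z : GroupLieAlgebra 𝓘(ℝ, E) G) (x : G) :
    SmoothAt (rightField z) x := by
  have h := contMDiff_partial (I₁ := 𝓘(ℝ, E)) (I₂ := 𝓘(ℝ, E)) (I₃ := 𝓘(ℝ, E))
    (Φ := fun p : G × G ↦ p.2 * p.1) (contMDiff_snd.mul contMDiff_fst) 1 z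
  have h2 : ∀ x : G, (⟨1 * x, mfderiv 𝓘(ℝ, E) 𝓘(ℝ, E) (fun y ↦ y * x) 1 z⟩ :
      TangentBundle 𝓘(ℝ, E) G) = ⟨x, rightField z x⟩ := fun x ↦
    tangentBundle_mk_congr (one_mul x) _
  simp only [h2] at h
  exact h x

/-- Conjugation fixes `1`, so the partial derivative is a map into the tangent bundle with constant
base point. The trivialization at `1` is the identity on the fibre over `1`, so smoothness passes to
the vector part. -/
theorem contMDiff_adInv (z : GroupLieAlgebra 𝓘(ℝ, E) G) :
    ContMDiff 𝓘(ℝ, E) 𝓘(ℝ, E) ∞ (adInv z : G → E) := by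
  have h := contMDiff_partial (I₁ := 𝓘(ℝ, E)) (I₂ := 𝓘(ℝ, E)) (I₃ := 𝓘(ℝ, E))
    (Φ := fun p : G × G ↦ p.1⁻¹ * p.2 * p.1) ((contMDiff_fst.inv.mul contMDiff_snd).mul
      contMDiff_fst) 1 z
  have h2 : ∀ x : G, (⟨x⁻¹ * 1 * x, mfderiv 𝓘(ℝ, E) 𝓘(ℝ, E) (fun y ↦ x⁻¹ * y * x) 1 z⟩ :
      TangentBundle 𝓘(ℝ, E) G) = ⟨1, adInv (E := E) z x⟩ := fun x ↦
    tangentBundle_mk_congr (by simp) _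
  simp only [h2] at h
  intro x
  have h3 := (Bundle.contMDiffAt_totalSpace.1 (h x)).2
  have h4 : ∀ w : E, (trivializationAt E (TangentSpace 𝓘(ℝ, E)) (1 : G)
      (⟨1, w⟩ : TangentBundle 𝓘(ℝ, E) G)).2 = w := fun w ↦ by
    have h5 := TangentBundle.continuousLinearMapAt_trivializationAt (I := 𝓘(ℝ, E))
      (mem_chart_source E (1 : G))
    rw [mfderiv_extChartAt_self] at h5
    have h6 := DFunLike.congr_fun h5 w
    exact ((trivializationAt E (TangentSpace 𝓘(ℝ, E))
      (1 : G)).continuousLinearMapAt_apply_of_mem ℝ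
      (FiberBundle.mem_baseSet_trivializationAt' (1 : G)) w).symm.trans h6
  simp only [h4] at h3
  exact h3

theorem mdifferentiableAt_mul_left (a x : G) :
    MDifferentiableAt 𝓘(ℝ, E) 𝓘(ℝ, E) (fun y ↦ a * y) x :=
  (contMDiff_mul_left (I := 𝓘(ℝ, E)) (n := ∞)).mdifferentiable (by simp) x

theorem mdifferentiableAt_mul_right (a x : G) :
    MDifferentiableAt 𝓘(ℝ, E) 𝓘(ℝ, E) (fun y ↦ y * a) x :=
  (contMDiff_mul_right (I := 𝓘(ℝ, E)) (n := ∞)).mdifferentiable (by simp) x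

theorem rightField_eq (z : GroupLieAlgebra 𝓘(ℝ, E) G) (x : G) :
    rightField z x = mulInvariantVectorField (adInv (E := E) z x) x := by
  have h1 : (fun y : G ↦ y * x) = (fun y ↦ x * y) ∘ (fun y ↦ x⁻¹ * y * x) := by
    ext y; simp [mul_assoc]
  have h2 : MDifferentiableAt 𝓘(ℝ, E) 𝓘(ℝ, E) (fun y : G ↦ x⁻¹ * y * x) 1 :=
    (mdifferentiableAt_mul_right x _).comp (1 : G) (mdifferentiableAt_mul_left x⁻¹ 1)
  rw [rightField, h1]
  exact mfderiv_comp_apply_of_eq (1 : G) (mdifferentiableAt_mul_left x _) h2 (by simp) z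

theorem mvfderiv_comp_mul_left {u : G → ℝ} (hu : ContMDiff 𝓘(ℝ, E) 𝓘(ℝ, ℝ) ∞ u) (x : G)
    (v : GroupLieAlgebra 𝓘(ℝ, E) G) :
    mvfderiv 𝓘(ℝ, E) (fun y ↦ u (x * y)) 1 v =
      mvfderiv 𝓘(ℝ, E) u x (mulInvariantVectorField v x) :=
  mvfderiv_comp_apply_of_eq (f := fun y ↦ x * y) 1 (hu.mdifferentiable (by simp) x)
    (mdifferentiableAt_mul_left x 1) (mul_one x) v

theorem mvfderiv_comp_mul_right {u : G → ℝ} (hu : ContMDiff 𝓘(ℝ, E) 𝓘(ℝ, ℝ) ∞ u) (x : G)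
    (z : GroupLieAlgebra 𝓘(ℝ, E) G) :
    mvfderiv 𝓘(ℝ, E) (fun y ↦ u (y * x)) 1 z = mvfderiv 𝓘(ℝ, E) u x (rightField z x) :=
  mvfderiv_comp_apply_of_eq (f := fun y ↦ y * x) 1 (hu.mdifferentiable (by simp) x)
    (mdifferentiableAt_mul_right x 1) (one_mul x) z

end LieGroup

/-! ### Left-invariant and right-invariant fields commute. -/

section Commute

open VectorField

variable {E : Type*} [NormedAddCommGroup E] [NormedSpace ℝ E]
  {G : Type*} [TopologicalSpace G] [ChartedSpace E G] [Group G]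

theorem mulInvariantVectorField_apply_one (v : GroupLieAlgebra 𝓘(ℝ, E) G) :
    mulInvariantVectorField v (1 : G) = v := by
  have : (fun y : G ↦ 1 * y) = id := by ext; simp
  rw [mulInvariantVectorField, this, mfderiv_id]
  rfl

theorem rightField_apply_one (z : GroupLieAlgebra 𝓘(ℝ, E) G) : rightField z (1 : G) = z := by
  have : (fun y : G ↦ y * 1) = id := by ext; simp
  rw [rightField, this, mfderiv_id]
  rfl

variable [LieGroup 𝓘(ℝ, E) ∞ G]

theorem inverse_mfderiv_extChartAt_symm {p : E}
    (hp : p ∈ (extChartAt 𝓘(ℝ, E) (1 : G)).target) :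
    (mfderiv 𝓘(ℝ, E) 𝓘(ℝ, E) (extChartAt 𝓘(ℝ, E) (1 : G)).symm p).inverse =
      mfderiv 𝓘(ℝ, E) 𝓘(ℝ, E) (extChartAt 𝓘(ℝ, E) (1 : G))
        ((extChartAt 𝓘(ℝ, E) (1 : G)).symm p) := by
  have : IsManifold 𝓘(ℝ, E) 1 G := .of_le (n := ∞) (by simp)
  have h1 := mfderiv_extChartAt_comp_mfderivWithin_extChartAt_symm hp
  have h2 := mfderivWithin_extChartAt_symm_comp_mfderiv_extChartAt hp
  rw [ModelWithCorners.range_eq_univ, mfderivWithin_univ] at h1 h2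
  exact ContinuousLinearMap.inverse_eq h2 h1

theorem fderiv_chart_comp {k : G → G} (hk : MDifferentiableAt 𝓘(ℝ, E) 𝓘(ℝ, E) k 1)
    {y : G} (hy : y ∈ (chartAt E (1 : G)).source) (hky : k 1 = y) (w : E) :
    (fderiv ℝ (fun q ↦ extChartAt 𝓘(ℝ, E) (1 : G) (k ((extChartAt 𝓘(ℝ, E) (1 : G)).symm q)))
      (extChartAt 𝓘(ℝ, E) (1 : G) 1) w : E) =
      mfderiv 𝓘(ℝ, E) 𝓘(ℝ, E) (extChartAt 𝓘(ℝ, E) (1 : G)) y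
        ((mfderiv 𝓘(ℝ, E) 𝓘(ℝ, E) k 1 w : E)) := by
  have : IsManifold 𝓘(ℝ, E) 1 G := .of_le (n := ∞) (by simp)
  set φ := extChartAt 𝓘(ℝ, E) (1 : G)
  have hφ0 : φ.symm (φ 1) = 1 := extChartAt_to_inv _
  have h1 : MDifferentiableAt 𝓘(ℝ, E) 𝓘(ℝ, E) φ.symm (φ 1) :=
    ((contMDiffOn_extChartAt_symm (I := 𝓘(ℝ, E)) (n := ∞) (1 : G)).contMDiffAt
      ((isOpen_extChartAt_target (1 : G)).mem_nhds
        (mem_extChartAt_target (1 : G)))).mdifferentiableAt (by simp)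
  have h2 : mfderiv 𝓘(ℝ, E) 𝓘(ℝ, E) φ.symm (φ 1) = ContinuousLinearMap.id ℝ E := by
    have := mfderivWithin_range_extChartAt_symm (I := 𝓘(ℝ, E)) (x := (1 : G))
    rw [ModelWithCorners.range_eq_univ, mfderivWithin_univ] at this
    exact this
  have h3 : MDifferentiableAt 𝓘(ℝ, E) 𝓘(ℝ, E) φ y := mdifferentiableAt_extChartAt hy
  have h4 : MDifferentiableAt 𝓘(ℝ, E) 𝓘(ℝ, E) (φ ∘ k) 1 :=
    MDifferentiableAt.comp (1 : G) (by rw [hky]; exact h3) hk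
  rw [← mfderiv_eq_fderiv]
  refine (mfderiv_comp_apply_of_eq (g := φ ∘ k) (f := φ.symm) (φ 1) h4 h1 hφ0 w).trans ?_
  rw [h2]
  exact mfderiv_comp_apply_of_eq (g := φ) (f := k) (1 : G) h3 hk hky w

theorem mpullback_extChartAt_symm_apply (W : ∀ x : G, TangentSpace 𝓘(ℝ, E) x) :
    (mpullback 𝓘(ℝ, E) 𝓘(ℝ, E) (extChartAt 𝓘(ℝ, E) (1 : G)).symm W
      (extChartAt 𝓘(ℝ, E) (1 : G) 1) : E) = W 1 := by
  have h1 := inverse_mfderiv_extChartAt_symm (mem_extChartAt_target (I := 𝓘(ℝ, E)) (1 : G))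
  have h2 := extChartAt_to_inv (I := 𝓘(ℝ, E)) (1 : G)
  have h3 : ∀ y : G, y = 1 → (mfderiv 𝓘(ℝ, E) 𝓘(ℝ, E) (extChartAt 𝓘(ℝ, E) (1 : G)) y (W y) : E)
      = W 1 := by
    rintro y rfl
    rw [mfderiv_extChartAt_self]
    rfl
  rw [mpullback, h1]
  exact h3 _ h2

/-- Left-invariant and right-invariant vector fields commute. -/
theorem mlieBracket_rightField_one [CompleteSpace E] (v z : GroupLieAlgebra 𝓘(ℝ, E) G) :
    mlieBracket 𝓘(ℝ, E) (mulInvariantVectorField v) (rightField z) (1 : G) = 0 := by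
  set φ := extChartAt 𝓘(ℝ, E) (1 : G) with hφ
  set p₀ : E := φ 1
  have h2le : (2 : WithTop ℕ∞) ≤ ∞ := WithTop.coe_le_coe.2 (le_top : (2 : ℕ∞) ≤ ⊤)
  have hφ0 : φ.symm p₀ = 1 := extChartAt_to_inv _
  have htarget : φ.target ∈ 𝓝 p₀ := (isOpen_extChartAt_target (1 : G)).mem_nhds
    (mem_extChartAt_target (1 : G))
  have hψ : ∀ p ∈ φ.target, ContMDiffAt 𝓘(ℝ, E) 𝓘(ℝ, E) ∞ φ.symm p := fun p hp ↦
    (contMDiffOn_extChartAt_symm (I := 𝓘(ℝ, E)) (n := ∞) (1 : G)).contMDiffAt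
      ((isOpen_extChartAt_target (1 : G)).mem_nhds hp)
  have hp₀ : p₀ ∈ φ.target := mem_extChartAt_target (1 : G)
  let m : E × E → E := fun q ↦ φ (φ.symm q.1 * φ.symm q.2)
  have hm : ContDiffAt ℝ ∞ m (p₀, p₀) := by
    have h1 : ContMDiffAt (𝓘(ℝ, E).prod 𝓘(ℝ, E)) 𝓘(ℝ, E) ∞
        (fun q : E × E ↦ φ.symm q.1 * φ.symm q.2) (p₀, p₀) :=
      ((hψ p₀ hp₀).comp (p₀, p₀) contMDiffAt_fst).mul ((hψ p₀ hp₀).comp (p₀, p₀) contMDiffAt_snd)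
    have h2 : ContMDiffAt (𝓘(ℝ, E).prod 𝓘(ℝ, E)) 𝓘(ℝ, E) ∞ m (p₀, p₀) := by
      refine ContMDiffAt.comp (p₀, p₀) (g := φ) ?_ h1
      simp only [hφ0, mul_one]
      exact contMDiffAt_extChartAt
    rw [← contMDiffAt_iff_contDiffAt]
    rw [← modelWithCornersSelf_prod, chartedSpaceSelf_prod] at h2
    exact h2
  have hmd : ∀ᶠ q in 𝓝 (p₀, p₀), DifferentiableAt ℝ m q := by
    have h1 : ContDiffAt ℝ 1 m (p₀, p₀) := hm.of_le (by simp)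
    filter_upwards [h1.eventually (by simp)] with q hq
    exact hq.differentiableAt (by simp)
  -- In the chart, left- and right-invariant fields are the partial derivatives of the
  -- multiplication `m` in its second and first argument. Their bracket at `p₀` is then the
  -- difference of the two mixed second derivatives of `m`, zero by symmetry.
  let X : E → E := fun p ↦ fderiv ℝ m (p, p₀) ((0, v) : E × E)
  let Z : E → E := fun p ↦ fderiv ℝ m (p₀, p) ((z, 0) : E × E)
  have hleft : mpullback 𝓘(ℝ, E) 𝓘(ℝ, E) φ.symm (mulInvariantVectorField v) =ᶠ[𝓝 p₀] X := by
    have hc : Filter.Tendsto (fun p : E ↦ (p, p₀)) (𝓝 p₀) (𝓝 (p₀, p₀)) :=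
      (Continuous.prodMk_left p₀).tendsto' _ _ rfl
    filter_upwards [htarget, hc.eventually hmd] with p hp hpd
    have h1 := fderiv_chart_comp (mdifferentiableAt_mul_left (E := E) (φ.symm p) 1)
      (by simpa [φ] using φ.map_target hp) (mul_one _) v
    rw [mpullback, inverse_mfderiv_extChartAt_symm hp]
    refine h1.symm.trans ?_
    have h2 : HasFDerivAt (fun q ↦ m (p, q)) ((fderiv ℝ m (p, p₀)).comp
        (ContinuousLinearMap.inr ℝ E E)) p₀ :=
      HasFDerivAt.comp (g := m) (f := fun q ↦ (p, q)) p₀ hpd.hasFDerivAt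
        (hasFDerivAt_prodMk_right p p₀)
    exact DFunLike.congr_fun h2.fderiv v
  have hright : mpullback 𝓘(ℝ, E) 𝓘(ℝ, E) φ.symm (rightField z) =ᶠ[𝓝 p₀] Z := by
    have hc : Filter.Tendsto (fun p : E ↦ (p₀, p)) (𝓝 p₀) (𝓝 (p₀, p₀)) :=
      (Continuous.prodMk_right p₀).tendsto' _ _ rfl
    filter_upwards [htarget, hc.eventually hmd] with p hp hpd
    have h1 := fderiv_chart_comp (mdifferentiableAt_mul_right (E := E) (φ.symm p) 1)
      (by simpa [φ] using φ.map_target hp) (one_mul _) z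
    rw [mpullback, inverse_mfderiv_extChartAt_symm hp]
    refine h1.symm.trans ?_
    have h2 : HasFDerivAt (fun q ↦ m (q, p)) ((fderiv ℝ m (p₀, p)).comp
        (ContinuousLinearMap.inl ℝ E E)) p₀ :=
      HasFDerivAt.comp (g := m) (f := fun q ↦ (q, p)) p₀ hpd.hasFDerivAt
        (hasFDerivAt_prodMk_left p₀ p)
    exact DFunLike.congr_fun h2.fderiv z
  have hdd : DifferentiableAt ℝ (fderiv ℝ m) (p₀, p₀) := by
    have h1 : ContDiffAt ℝ 1 (fderiv ℝ m) (p₀, p₀) := hm.fderiv_right (one_add_one_eq_two.trans_le h2le)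
    exact h1.differentiableAt (by simp)
  have hX : HasFDerivAt X _ p₀ := (HasFDerivAt.comp (g := fderiv ℝ m) (f := fun q ↦ (q, p₀)) p₀
    hdd.hasFDerivAt (hasFDerivAt_prodMk_left p₀ p₀)).clm_apply
    (hasFDerivAt_const ((0, v) : E × E) p₀)
  have hZ : HasFDerivAt Z _ p₀ := (HasFDerivAt.comp (g := fderiv ℝ m) (f := fun q ↦ (p₀, q)) p₀
    hdd.hasFDerivAt (hasFDerivAt_prodMk_right p₀ p₀)).clm_apply
    (hasFDerivAt_const ((z, 0) : E × E) p₀)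
  have hX0 : X p₀ = v := by
    rw [← hleft.self_of_nhds]
    exact (mpullback_extChartAt_symm_apply (mulInvariantVectorField v)).trans
      (mulInvariantVectorField_apply_one v)
  have hZ0 : Z p₀ = z := by
    rw [← hright.self_of_nhds]
    exact (mpullback_extChartAt_symm_apply (rightField z)).trans (rightField_apply_one z)
  have hml : ∀ A B : E → E, mlieBracket 𝓘(ℝ, E) A B p₀ = lieBracket ℝ A B p₀ := fun A B ↦ by
    have h6 := mlieBracketWithin_eq_lieBracketWithin (𝕜 := ℝ) (V := A) (W := B) (s := Set.univ)
    exact (congrFun (mlieBracketWithin_univ (V := fun x ↦ (A x : TangentSpace 𝓘(ℝ, E) x))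
      (W := fun x ↦ (B x : TangentSpace 𝓘(ℝ, E) x))) p₀).symm.trans
      ((congrFun h6 p₀).trans (congrFun lieBracketWithin_univ p₀))
  have hbr : mpullback 𝓘(ℝ, E) 𝓘(ℝ, E) φ.symm
      (mlieBracket 𝓘(ℝ, E) (mulInvariantVectorField v) (rightField z)) p₀ = 0 := by
    rw [mpullback_mlieBracket (n := ∞)]
    rotate_left
    · rw [hφ0]; exact (smoothAt_mulInvariantVectorField v 1).diffAt
    · rw [hφ0]; exact (smoothAt_rightField z 1).diffAt
    · exact hψ p₀ hp₀
    · rw [minSmoothness_of_isRCLikeNormedField]; exact h2le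
    refine (Filter.EventuallyEq.mlieBracket_vectorField_eq hleft hright).trans ((hml X Z).trans ?_)
    have hsymm : IsSymmSndFDerivAt ℝ m (p₀, p₀) := hm.isSymmSndFDerivAt (by
      rw [minSmoothness_of_isRCLikeNormedField]; exact h2le)
    have h5 := hsymm (0, v) (z, 0)
    rw [lieBracket, hX.fderiv, hZ.fderiv, hX0, hZ0]
    simp only [ContinuousLinearMap.comp_zero, zero_add]
    exact sub_eq_zero.2 h5
  exact (mpullback_extChartAt_symm_apply
    (mlieBracket 𝓘(ℝ, E) (mulInvariantVectorField v) (rightField z))).symm.trans hbr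

end Commute

/-! ### Unimodularity -/

section Unimodular

open MeasureTheory VectorField

variable {E : Type*} [NormedAddCommGroup E] [NormedSpace ℝ E] [FiniteDimensional ℝ E]
  {G : Type*} [TopologicalSpace G] [ChartedSpace E G] [Group G] [LieGroup 𝓘(ℝ, E) ∞ G]
  [MeasurableSpace G] [BorelSpace G]

/-- The derivatives along left-invariant fields of functions on `Γ \ G` have mean value zero. -/
theorem setIntegral_mvfderiv_eq_zero (Γ : Subgroup G) [Countable Γ] (μ : Measure G)
    [μ.IsMulLeftInvariant] [μ.IsMulRightInvariant] {F : Set G} (hF : IsFundamentalDomain Γ F μ)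
    (hF' : μ F < ⊤) (hFg : ∀ g : G, IsFundamentalDomain Γ ((· * g) ⁻¹' F) μ) {K : Set G}
    (hK : IsCompact K) (hΓK : ∀ x, ∃ γ : Γ, γ • x ∈ K) {u : G → ℝ}
    (hu : ContMDiff 𝓘(ℝ, E) 𝓘(ℝ, ℝ) ∞ u) (huΓ : ∀ (γ : Γ) x, u (γ • x) = u x)
    (v : GroupLieAlgebra 𝓘(ℝ, E) G) :
    ∫ x in F, mvfderiv 𝓘(ℝ, E) u x (mulInvariantVectorField v x) ∂μ = 0 := by
  have : IsTopologicalGroup G := topologicalGroup_of_lieGroup 𝓘(ℝ, E) ∞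
  obtain ⟨a, δ, ha, hδ, ha0, had⟩ := exists_curve (1 : G) v
  let H : ℝ × G → ℝ := fun p ↦ u (p.2 * a p.1)
  have hH : ContMDiff (𝓘(ℝ, ℝ).prod 𝓘(ℝ, E)) 𝓘(ℝ, ℝ) ∞ H :=
    hu.comp (contMDiff_snd.mul (ha.comp contMDiff_fst))
  have hHΓ : ∀ (γ : Γ) x t, H (t, γ • x) = H (t, x) := fun γ x t ↦ by
    simpa [H, Subgroup.smul_def, mul_assoc] using huΓ γ (x * a t)
  have hd := (contMDiff_partial_real hH).continuous
  have hI : IsCompact (Set.Icc (-1 : ℝ) 1) := isCompact_Icc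
  obtain ⟨C, hC⟩ := (hI.prod hK).exists_bound_of_continuousOn hd.continuousOn
  obtain ⟨C', hC'⟩ := hK.exists_bound_of_continuousOn
    (hH.continuous.comp (Continuous.prodMk_right (0 : ℝ))).continuousOn
  have hfin : IsFiniteMeasure (μ.restrict F) := ⟨by simpa using hF'⟩
  have h1 := integral_deriv_eq_zero hH (μ.restrict F) (bd := fun _ ↦ C) (integrable_const C)
    (fun x t ht ↦ by
      obtain ⟨γ, hγ⟩ := hΓK x
      rw [Real.ball_eq_Ioo] at ht
      have ht' : t ∈ Set.Ioo (-1 : ℝ) 1 := by simpa using ht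
      -- A bound over the compact set `K` is a bound everywhere, since `H` is `Γ`-invariant in its
      -- second argument.
      have := hC (t, γ • x) ⟨Set.Ioo_subset_Icc_self ht', hγ⟩
      simpa only [hHΓ, Real.norm_eq_abs] using this)
    (Integrable.of_bound
      (hH.continuous.comp (Continuous.prodMk_right (0 : ℝ))).measurable.aestronglyMeasurable C'
      (Filter.Eventually.of_forall fun x ↦ by
        obtain ⟨γ, hγ⟩ := hΓK x
        have := hC' (γ • x) hγ
        simpa only [Function.comp_apply, hHΓ] using this))
    (fun t ↦ by
      simp only [H]
      rw [setIntegral_comp_mul_right Γ μ hF hFg huΓ, setIntegral_comp_mul_right Γ μ hF hFg huΓ])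
  have h2 : ∀ x, deriv (fun t ↦ H (t, x)) 0 =
      δ * mvfderiv 𝓘(ℝ, E) u x (mulInvariantVectorField v x) := fun x ↦ by
    rw [← mvfderiv_comp_mul_left hu]
    exact (had (fun y ↦ u (x * y))
      ((hu.comp (contMDiff_mul_left (I := 𝓘(ℝ, E)))).mdifferentiable (by simp) 1)).deriv
  simp only [h2, integral_const_mul] at h1
  exact (mul_eq_zero.1 h1).resolve_left hδ

theorem integral_mvfderiv_mulInvariantVectorField_eq_zero [T2Space G] (μ : Measure G)
    [IsFiniteMeasureOnCompacts μ] [μ.IsMulRightInvariant] {u : G → ℝ}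
    (hu : ContMDiff 𝓘(ℝ, E) 𝓘(ℝ, ℝ) ∞ u) (hu' : HasCompactSupport u)
    (v : GroupLieAlgebra 𝓘(ℝ, E) G) :
    ∫ x, mvfderiv 𝓘(ℝ, E) u x (mulInvariantVectorField v x) ∂μ = 0 := by
  have : IsTopologicalGroup G := topologicalGroup_of_lieGroup 𝓘(ℝ, E) ∞
  obtain ⟨a, δ, ha, hδ, ha0, had⟩ := exists_curve (1 : G) v
  have h1 := integral_deriv_eq_zero_of_hasCompactSupport (Φ := fun p : ℝ × G ↦ p.2 * a p.1)
    (Ψ := fun p : ℝ × G ↦ p.2 * (a p.1)⁻¹)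
    (contMDiff_snd.mul (ha.comp contMDiff_fst))
    (continuous_snd.mul (ha.continuous.comp continuous_fst).inv) (by simp) μ hu hu'
    (fun t ↦ integral_mul_right_eq_self u (a t))
  have h2 : ∀ x, deriv (fun t ↦ u (x * a t)) 0 =
      δ * mvfderiv 𝓘(ℝ, E) u x (mulInvariantVectorField v x) := fun x ↦ by
    rw [← mvfderiv_comp_mul_left hu]
    exact (had (fun y ↦ u (x * y))
      ((hu.comp (contMDiff_mul_left (I := 𝓘(ℝ, E)))).mdifferentiable (by simp) 1)).deriv
  simp only [h2, integral_const_mul] at h1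
  exact (mul_eq_zero.1 h1).resolve_left hδ

theorem integral_mvfderiv_rightField_eq_zero [T2Space G] (μ : Measure G)
    [IsFiniteMeasureOnCompacts μ] [μ.IsMulLeftInvariant] {u : G → ℝ}
    (hu : ContMDiff 𝓘(ℝ, E) 𝓘(ℝ, ℝ) ∞ u) (hu' : HasCompactSupport u)
    (z : GroupLieAlgebra 𝓘(ℝ, E) G) :
    ∫ x, mvfderiv 𝓘(ℝ, E) u x (rightField z x) ∂μ = 0 := by
  have : IsTopologicalGroup G := topologicalGroup_of_lieGroup 𝓘(ℝ, E) ∞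
  obtain ⟨a, δ, ha, hδ, ha0, had⟩ := exists_curve (1 : G) z
  have h1 := integral_deriv_eq_zero_of_hasCompactSupport (Φ := fun p : ℝ × G ↦ a p.1 * p.2)
    (Ψ := fun p : ℝ × G ↦ (a p.1)⁻¹ * p.2)
    ((ha.comp contMDiff_fst).mul contMDiff_snd)
    ((ha.continuous.comp continuous_fst).inv.mul continuous_snd) (by simp) μ hu hu'
    (fun t ↦ integral_mul_left_eq_self u (a t))
  have h2 : ∀ x, deriv (fun t ↦ u (a t * x)) 0 =
      δ * mvfderiv 𝓘(ℝ, E) u x (rightField z x) := fun x ↦ by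
    rw [← mvfderiv_comp_mul_right hu]
    exact (had (fun y ↦ u (y * x))
      ((hu.comp (contMDiff_mul_right (I := 𝓘(ℝ, E)))).mdifferentiable (by simp) 1)).deriv
  simp only [h2, integral_const_mul] at h1
  exact (mul_eq_zero.1 h1).resolve_left hδ

end Unimodular

/-! ### Unimodularity of the Lie algebra through the divergence of right-invariant fields. -/

section Bracket

open VectorField

variable {E : Type*} [NormedAddCommGroup E] [NormedSpace ℝ E]
  {M : Type*} [TopologicalSpace M] [ChartedSpace E M] [IsManifold 𝓘(ℝ, E) ∞ M]

theorem diffAt_sum_smul {ι : Type*} (s : Finset ι) {a : ι → M → ℝ}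
    {W : ι → ∀ x : M, TangentSpace 𝓘(ℝ, E) x} {x : M}
    (ha : ∀ i ∈ s, MDifferentiableAt 𝓘(ℝ, E) 𝓘(ℝ, ℝ) (a i) x) (hW : ∀ i ∈ s, DiffAt (W i) x) :
    DiffAt (∑ i ∈ s, a i • W i) x := by
  have : IsManifold 𝓘(ℝ, E) 1 M := .of_le (n := ∞) (by simp)
  classical
  induction s using Finset.induction_on with
  | empty => exact (Bundle.contMDiff_zeroSection (n := ∞) ℝ (TangentSpace 𝓘(ℝ, E) (M := M))
      ).contMDiffAt.mdifferentiableAt (by simp)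
  | insert i s hi ih =>
    rw [Finset.sum_insert hi]
    exact mdifferentiableAt_add_section ((ha i (by simp)).smul_section (hW i (by simp)))
      (ih (fun j hj ↦ ha j (by simp [hj])) (fun j hj ↦ hW j (by simp [hj])))

theorem mlieBracket_sum_smul_right [CompleteSpace E] {ι : Type*} (s : Finset ι) {a : ι → M → ℝ}
    {V : ∀ x : M, TangentSpace 𝓘(ℝ, E) x} {W : ι → ∀ x : M, TangentSpace 𝓘(ℝ, E) x} {x : M}
    (ha : ∀ i ∈ s, MDifferentiableAt 𝓘(ℝ, E) 𝓘(ℝ, ℝ) (a i) x) (hW : ∀ i ∈ s, DiffAt (W i) x) :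
    mlieBracket 𝓘(ℝ, E) V (∑ i ∈ s, a i • W i) x =
      ∑ i ∈ s, (mvfderiv 𝓘(ℝ, E) (a i) x (V x) • W i x +
        a i x • mlieBracket 𝓘(ℝ, E) V (W i) x) := by
  have : IsManifold 𝓘(ℝ, E) (minSmoothness ℝ 2) M := by
    rw [minSmoothness_of_isRCLikeNormedField]; infer_instance
  have : IsManifold 𝓘(ℝ, E) 1 M := .of_le (n := ∞) (by simp)
  classical
  induction s using Finset.induction_on with
  | empty => simp
  | insert i s hi ih =>
    rw [Finset.sum_insert hi, Finset.sum_insert hi, ← ih (fun j hj ↦ ha j (by simp [hj]))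
      (fun j hj ↦ hW j (by simp [hj])), ← mlieBracket_smul_right (ha i (by simp)) (hW i (by simp))]
    exact mlieBracket_add_right ((ha i (by simp)).smul_section (hW i (by simp)))
      (diffAt_sum_smul s (fun j hj ↦ ha j (by simp [hj])) (fun j hj ↦ hW j (by simp [hj])))

end Bracket

section Trace

open MeasureTheory VectorField

variable {E : Type*} [NormedAddCommGroup E] [NormedSpace ℝ E]
  {G : Type*} [TopologicalSpace G] [ChartedSpace E G] [Group G]

theorem mulInvariantVectorField_sum_smul {ι : Type*} (s : Finset ι) (a : ι → ℝ)
    (b : ι → GroupLieAlgebra 𝓘(ℝ, E) G) (x : G) :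
    mulInvariantVectorField (∑ i ∈ s, a i • b i) x =
      ∑ i ∈ s, a i • mulInvariantVectorField (b i) x := by
  refine (map_sum (mfderiv 𝓘(ℝ, E) 𝓘(ℝ, E) (fun y : G ↦ x * y) 1) _ s).trans ?_
  exact Finset.sum_congr rfl fun i _ ↦
    map_smul (mfderiv 𝓘(ℝ, E) 𝓘(ℝ, E) (fun y : G ↦ x * y) 1) (a i) (b i)

instance [FiniteDimensional ℝ E] : FiniteDimensional ℝ (GroupLieAlgebra 𝓘(ℝ, E) G) :=
  inferInstanceAs (FiniteDimensional ℝ E)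

variable [LieGroup 𝓘(ℝ, E) ∞ G] {ι : Type*} (b : Module.Basis ι ℝ (GroupLieAlgebra 𝓘(ℝ, E) G))

/-- The coordinates of `Ad(x⁻¹) z`. -/
def adInvCoord (z : GroupLieAlgebra 𝓘(ℝ, E) G) (i : ι) (x : G) : ℝ :=
  b.repr (adInv (E := E) z x) i

theorem contMDiff_adInvCoord [FiniteDimensional ℝ E] (z : GroupLieAlgebra 𝓘(ℝ, E) G) (i : ι) :
    ContMDiff 𝓘(ℝ, E) 𝓘(ℝ, ℝ) ∞ (adInvCoord b z i) := by
  let l : E →ₗ[ℝ] ℝ := b.coord i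
  exact (LinearMap.toContinuousLinearMap l).contMDiff.comp (contMDiff_adInv z)

theorem rightField_eq_sum [Fintype ι] (z : GroupLieAlgebra 𝓘(ℝ, E) G) :
    rightField z = ∑ i, adInvCoord b z i • (mulInvariantVectorField (b i) :
      ∀ x : G, TangentSpace 𝓘(ℝ, E) x) := by
  funext x
  rw [rightField_eq, Finset.sum_apply]
  have h := b.sum_repr (adInv (E := E) z x)
  exact (congrArg (fun w ↦ mulInvariantVectorField w x) h.symm).trans
    (mulInvariantVectorField_sum_smul _ _ _ x)

/-- Expand the vanishing bracket of the left-invariant field of `v` with `rightField z` at `1`,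
writing the latter in the left-invariant frame with coefficients `adInvCoord b z i`. -/
theorem bracket_eq_sum_mvfderiv [FiniteDimensional ℝ E] [Fintype ι] (v z : GroupLieAlgebra 𝓘(ℝ, E) G) :
    ⁅z, v⁆ = ∑ i, (mvfderiv 𝓘(ℝ, E) (adInvCoord b z i) 1 v : ℝ) • b i := by
  have : CompleteSpace E := FiniteDimensional.complete ℝ E
  have h := mlieBracket_rightField_one v z
  rw [rightField_eq_sum b, mlieBracket_sum_smul_right _
    (fun i _ ↦ (contMDiff_adInvCoord b z i).mdifferentiable (by simp) 1)
    (fun i _ ↦ (smoothAt_mulInvariantVectorField (b i) 1).diffAt), Finset.sum_add_distrib] at h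
  simp only [mulInvariantVectorField_apply_one] at h
  have h2 : ∑ i, adInvCoord b z i (1 : G) • mlieBracket 𝓘(ℝ, E) (mulInvariantVectorField v)
      (mulInvariantVectorField (b i)) (1 : G) = ⁅v, z⁆ := by
    have h3 := b.sum_repr z
    conv_rhs => rw [← h3, lie_sum]
    refine Finset.sum_congr rfl fun i _ ↦ ?_
    rw [lie_smul, adInvCoord, adInv_one]
    rfl
  rw [h2] at h
  rw [← lie_skew]
  exact (eq_neg_of_add_eq_zero_left h).symm

theorem integrable_mvfderiv_apply {u : G → ℝ} (hu : ContMDiff 𝓘(ℝ, E) 𝓘(ℝ, ℝ) ∞ u)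
    (hu' : HasCompactSupport u) {X : ∀ x : G, TangentSpace 𝓘(ℝ, E) x} (hX : ∀ x, SmoothAt X x)
    [MeasurableSpace G] [BorelSpace G] (μ : Measure G) [IsFiniteMeasureOnCompacts μ] :
    Integrable (fun x ↦ mvfderiv 𝓘(ℝ, E) u x (X x)) μ := by
  have : IsTopologicalGroup G := topologicalGroup_of_lieGroup 𝓘(ℝ, E) ∞
  refine (contMDiff_mvfderiv_apply hu hX).continuous.integrable_of_hasCompactSupport
    (hu'.mono' fun x hx ↦ ?_)
  by_contra h
  have h0 : u =ᶠ[𝓝 x] fun _ ↦ 0 := notMem_tsupport_iff_eventuallyEq.1 h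
  refine hx ?_
  have h1 : mvfderiv 𝓘(ℝ, E) u x = mvfderiv 𝓘(ℝ, E) (fun _ ↦ (0 : ℝ)) x := h0.mfderiv_eq
  simp only [h1, mvfderiv_const]
  rfl

variable [FiniteDimensional ℝ E] [MeasurableSpace G] [BorelSpace G] [T2Space G]

/-- The Lie algebra of a unimodular group is unimodular. -/
theorem trace_ad_eq_zero [SigmaCompactSpace G] (μ : Measure G) [μ.IsHaarMeasure]
    [μ.IsMulRightInvariant] (z : GroupLieAlgebra 𝓘(ℝ, E) G) :
    LinearMap.trace ℝ (GroupLieAlgebra 𝓘(ℝ, E) G)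
      (LieAlgebra.ad ℝ (GroupLieAlgebra 𝓘(ℝ, E) G) z :
        GroupLieAlgebra 𝓘(ℝ, E) G →ₗ[ℝ] GroupLieAlgebra 𝓘(ℝ, E) G) = 0 := by
  let b := Module.finBasis ℝ (GroupLieAlgebra 𝓘(ℝ, E) G)
  have : IsTopologicalGroup G := topologicalGroup_of_lieGroup 𝓘(ℝ, E) ∞
  have : LocallyCompactSpace G := ChartedSpace.locallyCompactSpace E G
  -- `D` is the divergence of `rightField z`, computed in the left-invariant frame, whose fields are
  -- divergence-free by right invariance of `μ`.
  let D : G → ℝ := fun x ↦ ∑ i, mvfderiv 𝓘(ℝ, E) (adInvCoord b z i) x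
    (mulInvariantVectorField (b i) x)
  have hi : ∀ i, Continuous fun x : G ↦ mvfderiv 𝓘(ℝ, E) (adInvCoord b z i) x
      (mulInvariantVectorField (b i) x) := fun i ↦
    (contMDiff_mvfderiv_apply (contMDiff_adInvCoord b z i)
      (smoothAt_mulInvariantVectorField (b i))).continuous
  have hD : Continuous D := continuous_finsetSum _ fun i _ ↦ hi i
  -- Test against `u`: by the product rule `u D` is a sum of left-invariant derivatives of `u *
  -- adInvCoord b z i` minus the derivative of `u` along `rightField z`. These integrate to zero by
  -- right and left invariance of `μ` respectively.
  have hae : ∀ᵐ x ∂μ, D x = 0 := by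
    refine ae_eq_zero_of_integral_contMDiff_smul_eq_zero 𝓘(ℝ, E) hD.locallyIntegrable
      fun u hu hu' ↦ ?_
    have hprod : ∀ i x, mvfderiv 𝓘(ℝ, E) (u * adInvCoord b z i) x
        (mulInvariantVectorField (b i) x) =
        u x * mvfderiv 𝓘(ℝ, E) (adInvCoord b z i) x (mulInvariantVectorField (b i) x) +
        mvfderiv 𝓘(ℝ, E) u x (adInvCoord b z i x • mulInvariantVectorField (b i) x) :=
      fun i x ↦ by
        rw [mvfderiv_mul (hu.mdifferentiable (by simp) x)
          ((contMDiff_adInvCoord b z i).mdifferentiable (by simp) x), map_smul]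
        simp
    have h1 : ∀ i, ∫ x, mvfderiv 𝓘(ℝ, E) (u * adInvCoord b z i) x
        (mulInvariantVectorField (b i) x) ∂μ = 0 := fun i ↦
      integral_mvfderiv_mulInvariantVectorField_eq_zero μ (hu.mul (contMDiff_adInvCoord b z i))
        hu'.mul_right (b i)
    have h2 := integral_mvfderiv_rightField_eq_zero μ hu hu' z
    have h3 : ∀ x, u x • D x = ∑ i, mvfderiv 𝓘(ℝ, E) (u * adInvCoord b z i) x
        (mulInvariantVectorField (b i) x) - mvfderiv 𝓘(ℝ, E) u x (rightField z x) := fun x ↦ by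
      rw [rightField_eq_sum b, Finset.sum_apply, map_sum]
      simp only [D, hprod, Finset.sum_add_distrib, smul_eq_mul, Finset.mul_sum]
      exact (add_sub_cancel_right _ _).symm
    simp only [h3]
    rw [integral_sub, integral_finsetSum, h2, Finset.sum_eq_zero fun i _ ↦ h1 i, sub_zero]
    · exact fun i _ ↦ integrable_mvfderiv_apply (hu.mul (contMDiff_adInvCoord b z i)) hu'.mul_right
        (smoothAt_mulInvariantVectorField (b i)) μ
    · exact integrable_finsetSum _ fun i _ ↦ integrable_mvfderiv_apply
        (hu.mul (contMDiff_adInvCoord b z i)) hu'.mul_right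
        (smoothAt_mulInvariantVectorField (b i)) μ
    · exact integrable_mvfderiv_apply hu hu' (smoothAt_rightField z) μ
  have h0 : D = 0 := (hD.ae_eq_iff_eq μ continuous_const).1 hae
  have h1 : D 1 = 0 := congrFun h0 1
  rw [LinearMap.trace_eq_matrix_trace ℝ b, Matrix.trace, ← h1]
  refine Finset.sum_congr rfl fun i _ ↦ ?_
  rw [Matrix.diag_apply, LinearMap.toMatrix_apply, LieAlgebra.ad_apply,
    bracket_eq_sum_mvfderiv b (b i) z, map_sum, mulInvariantVectorField_apply_one]
  simp [Finsupp.single_apply]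

end Trace

/-! ### The Levi-Civita connection of an invariant metric -/

section Koszul

variable {L : Type*} [LieRing L] [LieAlgebra ℝ L] [FiniteDimensional ℝ L]

/-- The Koszul formula for frame fields: their inner products are constant, so only the bracket
terms remain. -/
theorem exists_koszul (B : L →ₗ[ℝ] L →ₗ[ℝ] ℝ)
    (hpos : ∀ x, x ≠ 0 → 0 < B x x) :
    ∃ Λ : L →ₗ[ℝ] L →ₗ[ℝ] L, ∀ v w u,
      2 * B (Λ v w) u = B ⁅v, w⁆ u - B ⁅w, u⁆ v + B ⁅u, v⁆ w := by
  have hinj : Function.Injective B := (injective_iff_map_eq_zero B).2 fun x hx ↦ by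
    by_contra h
    exact (hpos x h).ne' (by rw [hx]; rfl)
  let e : L ≃ₗ[ℝ] Module.Dual ℝ L := LinearMap.linearEquivOfInjective B hinj
    Subspace.dual_finrank_eq.symm
  let R : L →ₗ[ℝ] L →ₗ[ℝ] Module.Dual ℝ L := LinearMap.mk₂ ℝ (fun v w ↦ (1 / 2 : ℝ) •
    (B ⁅v, w⁆ - (B.flip v) ∘ₗ (LieAlgebra.ad ℝ L w : L →ₗ[ℝ] L)
      - (B.flip w) ∘ₗ (LieAlgebra.ad ℝ L v : L →ₗ[ℝ] L)))
    (fun x y z ↦ by ext u; simp; ring) (fun c x y ↦ by ext u; simp; ring)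
    (fun x y z ↦ by ext u; simp; ring) (fun c x y ↦ by ext u; simp; ring)
  refine ⟨R.compr₂ e.symm.toLinearMap, fun v w u ↦ ?_⟩
  have h : B (e.symm (R v w)) = R v w := e.apply_symm_apply _
  have h2 : B ⁅u, v⁆ w = -B ⁅v, u⁆ w := by
    rw [← lie_skew u v, map_neg, LinearMap.neg_apply]
  rw [LinearMap.compr₂_apply, LinearEquiv.coe_coe, h, h2]
  simp [R]
  ring

end Koszul

section LeviCivita

open VectorField

variable {E : Type*} [NormedAddCommGroup E] [NormedSpace ℝ E]
  {M : Type*} [TopologicalSpace M] [ChartedSpace E M]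

variable {L : Type*} [LieRing L] [LieAlgebra ℝ L]
  {V : ∀ p : M, L ≃ₗ[ℝ] TangentSpace 𝓘(ℝ, E) p}

variable (V) in
/-- The coordinates of a vector field in a frame. -/
def frameCoord {ι : Type*} (b : Module.Basis ι ℝ L) (Y : ∀ x : M, TangentSpace 𝓘(ℝ, E) x) (i : ι)
    (p : M) : ℝ := b.repr ((V p).symm (Y p)) i

theorem continuous_of_tangentSpace [FiniteDimensional ℝ E] {p q : M}
    (l : TangentSpace 𝓘(ℝ, E) p →ₗ[ℝ] TangentSpace 𝓘(ℝ, E) q) : Continuous l := by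
  let l' : E →ₗ[ℝ] E := l
  exact l'.continuous_of_finiteDimensional

variable (V) in
/-- The covariant derivative with Christoffel symbols `Λ` in the frame `V`. -/
def frameDeriv [FiniteDimensional ℝ E] {ι : Type*} [Fintype ι] (b : Module.Basis ι ℝ L)
    (Λ : L →ₗ[ℝ] L →ₗ[ℝ] L)
    (Y : ∀ x : M, TangentSpace 𝓘(ℝ, E) x) (p : M) :
    TangentSpace 𝓘(ℝ, E) p →L[ℝ] TangentSpace 𝓘(ℝ, E) p :=
  { toLinearMap := (V p).toLinearMap ∘ₗ
      (∑ i, (mvfderiv 𝓘(ℝ, E) (frameCoord V b Y i) p).toLinearMap.smulRight (b i) +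
        Λ.flip ((V p).symm (Y p)) ∘ₗ (V p).symm.toLinearMap)
    cont := continuous_of_tangentSpace _ }

theorem frameDeriv_apply [FiniteDimensional ℝ E] {ι : Type*} [Fintype ι] (b : Module.Basis ι ℝ L)
    (Λ : L →ₗ[ℝ] L →ₗ[ℝ] L)
    (Y : ∀ x : M, TangentSpace 𝓘(ℝ, E) x) (p : M) (v : TangentSpace 𝓘(ℝ, E) p) :
    frameDeriv V b Λ Y p v = V p (∑ i, (mvfderiv 𝓘(ℝ, E) (frameCoord V b Y i) p v : ℝ) • b i +
      Λ ((V p).symm v) ((V p).symm (Y p))) := by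
  change V p ((∑ i : ι, (mvfderiv 𝓘(ℝ, E) (frameCoord V b Y i) p).toLinearMap.smulRight (b i) +
      Λ.flip ((V p).symm (Y p)) ∘ₗ (V p).symm.toLinearMap) v) = _
  rw [LinearMap.add_apply, LinearMap.sum_apply]
  rfl

variable [IsManifold 𝓘(ℝ, E) ∞ M]

theorem mdifferentiableAt_inner (g : Metric E M) {Y Z : ∀ x : M, TangentSpace 𝓘(ℝ, E) x} {x : M}
    (hY : DiffAt Y x) (hZ : DiffAt Z x) :
    MDifferentiableAt 𝓘(ℝ, E) 𝓘(ℝ, ℝ) (fun y ↦ g.inner y (Y y) (Z y)) x := by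
  have : IsManifold 𝓘(ℝ, E) 1 M := .of_le (n := ∞) (by simp)
  have h := MDifferentiableAt.clm_bundle_apply₂ (E₃ := Bundle.Trivial M ℝ) (F₃ := ℝ)
    (g.contMDiff.mdifferentiable (by simp) x) hY hZ
  exact ((mdifferentiableAt_totalSpace _ _).1 h).2

/-- `V` is a global frame of smooth vector fields that is a representation of `L`. -/
structure IsLieFrame (V : ∀ p : M, L ≃ₗ[ℝ] TangentSpace 𝓘(ℝ, E) p) : Prop where
  smooth : ∀ v p, SmoothAt (fun q ↦ V q v) p
  bracket : ∀ v w p, mlieBracket 𝓘(ℝ, E) (fun q ↦ V q v) (fun q ↦ V q w) p = V p ⁅v, w⁆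

end LeviCivita

section FrameConnection

open VectorField

variable {E : Type*} [NormedAddCommGroup E] [NormedSpace ℝ E]
  {M : Type*} [TopologicalSpace M] [ChartedSpace E M]
  {L : Type*} [LieRing L] [LieAlgebra ℝ L]
  {V : ∀ p : M, L ≃ₗ[ℝ] TangentSpace 𝓘(ℝ, E) p}

theorem mvfderiv_sum_apply {ι : Type*} (s : Finset ι) {f : ι → M → ℝ} {p : M}
    (hf : ∀ i ∈ s, MDifferentiableAt 𝓘(ℝ, E) 𝓘(ℝ, ℝ) (f i) p) (v : TangentSpace 𝓘(ℝ, E) p) :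
    (mvfderiv 𝓘(ℝ, E) (∑ i ∈ s, f i) p v : ℝ) = ∑ i ∈ s, mvfderiv 𝓘(ℝ, E) (f i) p v := by
  have hs : ∀ s' ⊆ s, MDifferentiableAt 𝓘(ℝ, E) 𝓘(ℝ, ℝ) (∑ i ∈ s', f i) p ∧
      (mvfderiv 𝓘(ℝ, E) (∑ i ∈ s', f i) p v : ℝ) = ∑ i ∈ s', mvfderiv 𝓘(ℝ, E) (f i) p v := by
    classical
    intro s' hs'
    induction s' using Finset.induction_on with
    | empty => exact ⟨mdifferentiableAt_const, by simp [mvfderiv_zero]⟩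
    | insert i t hi ih =>
      obtain ⟨h1, h2⟩ := ih fun j hj ↦ hs' (by simp [hj])
      have h3 := hf i (hs' (by simp))
      rw [Finset.sum_insert hi, Finset.sum_insert hi]
      refine ⟨h3.add h1, ?_⟩
      rw [mvfderiv_add h3 h1, ← h2]
      rfl
  exact (hs s subset_rfl).2

theorem eq_sum_frameCoord {ι : Type*} [Fintype ι] (b : Module.Basis ι ℝ L) (Y : ∀ x : M, TangentSpace 𝓘(ℝ, E) x) (p : M) :
    Y p = ∑ i, frameCoord V b Y i p • V p (b i) := by
  have h := congrArg (V p) (b.sum_repr ((V p).symm (Y p)))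
  rw [LinearEquiv.apply_symm_apply, map_sum] at h
  rw [← h]
  exact Finset.sum_congr rfl fun i _ ↦ (map_smul (V p) _ _)

variable [IsManifold 𝓘(ℝ, E) ∞ M] {g : Metric E M} {B : L →ₗ[ℝ] L →ₗ[ℝ] ℝ}
  {ι : Type*} [Fintype ι] [DecidableEq ι] {b : Module.Basis ι ℝ L}

theorem frameCoord_eq (hgB : ∀ p v w, g.inner p (V p v) (V p w) = B v w)
    (hb : ∀ i j, B (b i) (b j) = if i = j then 1 else 0) (Y : ∀ x : M, TangentSpace 𝓘(ℝ, E) x)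
    (i : ι) (p : M) : frameCoord V b Y i p = g.inner p (V p (b i)) (Y p) := by
  rw [frameCoord, repr_eq_of_orthonormal hb, ← hgB p, LinearEquiv.apply_symm_apply]

/-- Orthonormality of `b` makes each coordinate an inner product with a smooth frame field. -/
theorem mdifferentiableAt_frameCoord (hV : IsLieFrame V)
    (hgB : ∀ p v w, g.inner p (V p v) (V p w) = B v w)
    (hb : ∀ i j, B (b i) (b j) = if i = j then 1 else 0) {Y : ∀ x : M, TangentSpace 𝓘(ℝ, E) x}
    {p : M} (hY : DiffAt Y p) (i : ι) :
    MDifferentiableAt 𝓘(ℝ, E) 𝓘(ℝ, ℝ) (frameCoord V b Y i) p := by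
  have h : frameCoord V b Y i = fun q ↦ g.inner q (V q (b i)) (Y q) :=
    funext fun q ↦ frameCoord_eq hgB hb Y i q
  rw [h]
  exact mdifferentiableAt_inner g (hV.smooth (b i) p).diffAt hY

variable [FiniteDimensional ℝ E]

/-- The covariant derivative with Christoffel symbols `Λ` in the frame `V`. -/
def frameConnection (hV : IsLieFrame V) (hgB : ∀ p v w, g.inner p (V p v) (V p w) = B v w)
    (hb : ∀ i j, B (b i) (b j) = if i = j then 1 else 0) (Λ : L →ₗ[ℝ] L →ₗ[ℝ] L) :
    CovariantDerivative 𝓘(ℝ, E) E (fun x : M ↦ TangentSpace 𝓘(ℝ, E) x) where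
  toFun := frameDeriv V b Λ
  isCovariantDerivativeOnUniv :=
    { add := fun {Y Z p} hY hZ _ ↦ by
        ext v
        have h : ∀ i, (mvfderiv 𝓘(ℝ, E) (frameCoord V b (Y + Z) i) p v : ℝ) =
            mvfderiv 𝓘(ℝ, E) (frameCoord V b Y i) p v +
              mvfderiv 𝓘(ℝ, E) (frameCoord V b Z i) p v := fun i ↦ by
          have h1 : frameCoord V b (Y + Z) i = frameCoord V b Y i + frameCoord V b Z i := by
            ext q; simp [frameCoord]
          rw [h1, mvfderiv_add (mdifferentiableAt_frameCoord hV hgB hb hY i)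
            (mdifferentiableAt_frameCoord hV hgB hb hZ i)]
          rfl
        rw [add_apply]
        simp only [frameDeriv_apply, h, add_smul, Finset.sum_add_distrib, Pi.add_apply, map_add]
        abel
      leibniz := fun {Y f p} hY hf _ ↦ by
        ext v
        have h : ∀ i, (mvfderiv 𝓘(ℝ, E) (frameCoord V b (f • Y) i) p v : ℝ) =
            f p * mvfderiv 𝓘(ℝ, E) (frameCoord V b Y i) p v +
              mvfderiv 𝓘(ℝ, E) f p v * frameCoord V b Y i p := fun i ↦ by
          have h1 : frameCoord V b (f • Y) i = f * frameCoord V b Y i := by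
            ext q; simp [frameCoord]
          rw [h1, mvfderiv_mul hf (mdifferentiableAt_frameCoord hV hgB hb hY i)]
          simp [mul_comm]
        rw [add_apply, smul_apply,
          ContinuousLinearMap.smulRight_apply]
        simp only [frameDeriv_apply, h, add_smul, Finset.sum_add_distrib, Pi.smul_apply', map_add,
          map_smul, smul_add, mul_smul, ← Finset.smul_sum]
        rw [map_sum (V p) (fun i ↦ frameCoord V b Y i p • b i)]
        simp only [map_smul]
        rw [← eq_sum_frameCoord b Y p]
        abel }

theorem frameConnection_apply (hV : IsLieFrame V)
    (hgB : ∀ p v w, g.inner p (V p v) (V p w) = B v w)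
    (hb : ∀ i j, B (b i) (b j) = if i = j then 1 else 0) (Λ : L →ₗ[ℝ] L →ₗ[ℝ] L)
    (Y : ∀ x : M, TangentSpace 𝓘(ℝ, E) x) (p : M) (v : TangentSpace 𝓘(ℝ, E) p) :
    frameConnection hV hgB hb Λ Y p v =
      V p (∑ i, (mvfderiv 𝓘(ℝ, E) (frameCoord V b Y i) p v : ℝ) • b i +
        Λ ((V p).symm v) ((V p).symm (Y p))) :=
  frameDeriv_apply b Λ Y p v

theorem frameConnection_frame (hV : IsLieFrame V)
    (hgB : ∀ p v w, g.inner p (V p v) (V p w) = B v w)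
    (hb : ∀ i j, B (b i) (b j) = if i = j then 1 else 0) (Λ : L →ₗ[ℝ] L →ₗ[ℝ] L)
    (v w : L) (p : M) :
    frameConnection hV hgB hb Λ (fun q ↦ V q w) p (V p v) = V p (Λ v w) := by
  have h : ∀ i, frameCoord V b (fun q ↦ V q w) i = fun _ ↦ b.repr w i := fun i ↦ by
    ext q; simp [frameCoord]
  simp [frameConnection_apply, h, mvfderiv_const]

/-- Torsion is tensorial and can be tested on the frame. Metricity is the Leibniz rule in
orthonormal coordinates plus skewness of each `Λ u`. -/
theorem isLeviCivita_frameConnection (hV : IsLieFrame V)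
    (hgB : ∀ p v w, g.inner p (V p v) (V p w) = B v w)
    (hb : ∀ i j, B (b i) (b j) = if i = j then 1 else 0) (Λ : L →ₗ[ℝ] L →ₗ[ℝ] L)
    (htor : ∀ v w, Λ v w - Λ w v = ⁅v, w⁆) (hmet : ∀ u v w, B (Λ u v) w + B v (Λ u w) = 0) :
    IsLeviCivita g (frameConnection hV hgB hb Λ) where
  torsion_free p X Y hX hY := by
    have : CompleteSpace E := FiniteDimensional.complete ℝ E
    have : IsManifold 𝓘(ℝ, E) 2 M := .of_le (n := ∞)
      (WithTop.coe_le_coe.2 (le_top : (2 : ℕ∞) ≤ ⊤))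
    set D := frameConnection hV hgB hb Λ
    have h0 : ∀ v w, D.torsion p (V p v) (V p w) = 0 := fun v w ↦ by
      have h1 := D.torsion_apply (X := fun q ↦ V q v) (Y := fun q ↦ V q w) (x := p)
        (hV.smooth v p).diffAt (hV.smooth w p).diffAt
      rw [h1, hV.bracket, frameConnection_frame, frameConnection_frame, ← map_sub, htor, sub_self]
    have h1 := D.torsion_apply hX hY
    have h2 := h0 ((V p).symm (X p)) ((V p).symm (Y p))
    rw [LinearEquiv.apply_symm_apply, LinearEquiv.apply_symm_apply, h1] at h2
    exact sub_eq_zero.1 h2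
  metric p v Y Z hY hZ := by
    have hB : ∀ x y, B x y = ∑ i, b.repr x i * b.repr y i := fun x y ↦ by
      conv_lhs => rw [← b.sum_repr x]
      rw [map_sum, LinearMap.sum_apply]
      simp only [map_smul, LinearMap.smul_apply, smul_eq_mul, repr_eq_of_orthonormal hb y]
    have hgB' : ∀ q (x y : TangentSpace 𝓘(ℝ, E) q), g.inner q x y =
        B ((V q).symm x) ((V q).symm y) := fun q x y ↦ by
      rw [← hgB q, LinearEquiv.apply_symm_apply, LinearEquiv.apply_symm_apply]
    have h1 : (fun q ↦ g.inner q (Y q) (Z q)) =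
        ∑ i, frameCoord V b Y i * frameCoord V b Z i := by
      ext q
      rw [hgB', hB, Finset.sum_apply]
      rfl
    have h2 : (mvfderiv 𝓘(ℝ, E) (∑ i, frameCoord V b Y i * frameCoord V b Z i) p v : ℝ) =
        ∑ i, (frameCoord V b Y i p * mvfderiv 𝓘(ℝ, E) (frameCoord V b Z i) p v +
          mvfderiv 𝓘(ℝ, E) (frameCoord V b Y i) p v * frameCoord V b Z i p) := by
      rw [mvfderiv_sum_apply _ fun i _ ↦ (mdifferentiableAt_frameCoord hV hgB hb hY i).mul
        (mdifferentiableAt_frameCoord hV hgB hb hZ i)]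
      refine Finset.sum_congr rfl fun i _ ↦ ?_
      rw [mvfderiv_mul (mdifferentiableAt_frameCoord hV hgB hb hY i)
        (mdifferentiableAt_frameCoord hV hgB hb hZ i)]
      simp [mul_comm]
    have h3 := hmet ((V p).symm v) ((V p).symm (Y p)) ((V p).symm (Z p))
    rw [h1, h2, hgB', hgB', frameConnection_apply, frameConnection_apply,
      LinearEquiv.symm_apply_apply, LinearEquiv.symm_apply_apply, map_add, map_add,
      LinearMap.add_apply]
    have h4 : ∀ x (c : ι → ℝ), B x (∑ i, c i • b i) = ∑ i, b.repr x i * c i := fun x c ↦ by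
      rw [hB]; simp [Finsupp.single_apply]
    have h5 : ∀ x (c : ι → ℝ), B (∑ i, c i • b i) x = ∑ i, c i * b.repr x i := fun x c ↦ by
      rw [hB]; simp [Finsupp.single_apply]
    rw [h4, h5, Finset.sum_add_distrib]
    simp only [frameCoord] at *
    linarith

theorem isParallel_of_ad_skew [FiniteDimensional ℝ L] (hV : IsLieFrame V)
    (hgB : ∀ p v w, g.inner p (V p v) (V p w) = B v w) (hsymm : ∀ x y, B x y = B y x)
    (hpos : ∀ x, x ≠ 0 → 0 < B x x) {θ : ∀ x : M, TangentSpace 𝓘(ℝ, E) x →L[ℝ] ℝ}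
    (θ₀ : L →ₗ[ℝ] ℝ) (hθ : ∀ p v, θ p (V p v) = θ₀ v) (hθ₀ : ∀ v w : L, θ₀ ⁅v, w⁆ = 0) (A : L)
    (hA : ∀ y, B A y = θ₀ y) (hskew : ∀ x y : L, B ⁅A, x⁆ y + B x ⁅A, y⁆ = 0) :
    IsParallel g θ := by
  obtain ⟨b, hb⟩ := exists_orthonormal_basis B hsymm hpos
  obtain ⟨Λ, hΛ⟩ := exists_koszul B hpos
  have hext : ∀ x y, (∀ u, B x u = B y u) → x = y := fun x y h ↦ by
    by_contra hxy
    have := hpos (x - y) (sub_ne_zero.2 hxy)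
    rw [show B (x - y) = B x - B y from map_sub B x y, LinearMap.sub_apply, h, sub_self] at this
    exact lt_irrefl _ this
  have hneg : ∀ x y z : L, B ⁅x, y⁆ z = -B ⁅y, x⁆ z := fun x y z ↦ by
    rw [← lie_skew x y, map_neg, LinearMap.neg_apply]
  have htor : ∀ v w, Λ v w - Λ w v = ⁅v, w⁆ := fun v w ↦ hext _ _ fun u ↦ by
    rw [show B (Λ v w - Λ w v) = B (Λ v w) - B (Λ w v) from map_sub B _ _, LinearMap.sub_apply]
    have h1 := hΛ v w u
    have h2 := hΛ w v u
    rw [hneg w v, hneg v u, hneg u w] at h2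
    linarith
  have hmet : ∀ u v w, B (Λ u v) w + B v (Λ u w) = 0 := fun u v w ↦ by
    have h1 := hΛ u v w
    have h2 := hΛ u w v
    rw [hsymm v]
    rw [hneg w v, hneg v u] at h2
    rw [hneg u v] at h1
    have h3 := hneg u v w
    have h4 := hneg w u v
    have h5 := hneg u w v
    linarith
  -- The Koszul formula with `u = A`: closedness of `θ₀` kills the term with `⁅v, w⁆`, and skewness
  -- of `ad A` cancels the other two.
  have hpar : ∀ v w, θ₀ (Λ v w) = 0 := fun v w ↦ by
    have h1 := hΛ v w A
    rw [← hA, hsymm A]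
    have h2 := hskew v w
    rw [hsymm v] at h2
    rw [hsymm ⁅v, w⁆ A, hA, hθ₀, hneg w A] at h1
    linarith
  refine ⟨frameConnection hV hgB hb Λ, isLeviCivita_frameConnection hV hgB hb Λ htor hmet,
    fun p v Y hY ↦ ?_⟩
  have h1 : (fun q ↦ θ q (Y q)) = ∑ i, frameCoord V b Y i * fun _ ↦ θ₀ (b i) := by
    ext q
    rw [eq_sum_frameCoord (V := V) b Y q, map_sum, Finset.sum_apply]
    exact Finset.sum_congr rfl fun i _ ↦ by rw [map_smul, hθ]; rfl
  have h2 := fun i ↦ mdifferentiableAt_frameCoord hV hgB hb hY i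
  rw [h1, mvfderiv_sum_apply _ fun i _ ↦ (h2 i).mul mdifferentiableAt_const, frameConnection_apply,
    hθ, map_add, hpar, add_zero, map_sum]
  refine Finset.sum_congr rfl fun i _ ↦ ?_
  rw [mvfderiv_mul (h2 i) mdifferentiableAt_const, map_smul]
  simp [mvfderiv_const, mul_comm]

end FrameConnection

/-! ### The invariant frame of `Γ \ G` -/

section Frame

open VectorField

variable {E : Type*} [NormedAddCommGroup E] [NormedSpace ℝ E]
  {G : Type*} [TopologicalSpace G] [ChartedSpace E G] [Group G] [LieGroup 𝓘(ℝ, E) ∞ G]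
  (Γ : Subgroup G) [DiscreteTopology Γ]

theorem contMDiff_proj : ContMDiff 𝓘(ℝ, E) 𝓘(ℝ, E) ∞ (proj Γ) :=
  (isLocalDiffeomorph_proj Γ).contMDiff

/-- The image in `Γ \ G` of the value at `x` of a left-invariant vector field. -/
def projField (x : G) (v : GroupLieAlgebra 𝓘(ℝ, E) G) : E :=
  mfderiv 𝓘(ℝ, E) 𝓘(ℝ, E) (proj Γ) x (mulInvariantVectorField v x)

theorem projField_eq_mfderiv (x : G) (v : GroupLieAlgebra 𝓘(ℝ, E) G) :
    projField Γ x v = mfderiv 𝓘(ℝ, E) 𝓘(ℝ, E) (fun y ↦ proj Γ (x * y)) 1 v :=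
  (mfderiv_comp_apply_of_eq (f := fun y ↦ x * y) (g := proj Γ) (1 : G)
    ((contMDiff_proj Γ).mdifferentiable (by simp) x) (mdifferentiableAt_mul_left x 1) (mul_one x)
    v).symm

/-- `x` and `y` differ by a left factor in `Γ`, so the maps `z ↦ proj Γ (x * z)` and `z ↦ proj Γ (y
* z)` coincide. This makes `invFrame` independent of the chosen representative. -/
theorem projField_congr {x y : G} (h : proj Γ x = proj Γ y) (v : GroupLieAlgebra 𝓘(ℝ, E) G) :
    projField Γ x v = projField Γ y v := by
  rw [projField_eq_mfderiv, projField_eq_mfderiv]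
  have h1 : (fun z ↦ proj Γ (x * z)) = fun z ↦ proj Γ (y * z) := by
    ext z
    have h2 := proj_mul_left Γ ((proj_eq_iff Γ).1 h) (x * z)
    rw [← h2]
    simp [mul_assoc]
  rw [h1]
  rfl

theorem projField_add (x : G) (v w : GroupLieAlgebra 𝓘(ℝ, E) G) :
    projField Γ x (v + w) = projField Γ x v + projField Γ x w := by
  simp only [projField_eq_mfderiv]
  exact map_add (mfderiv 𝓘(ℝ, E) 𝓘(ℝ, E) (fun y ↦ proj Γ (x * y)) 1) v w

theorem projField_smul (x : G) (c : ℝ) (v : GroupLieAlgebra 𝓘(ℝ, E) G) :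
    projField Γ x (c • v) = c • projField Γ x v := by
  simp only [projField_eq_mfderiv]
  exact map_smul (mfderiv 𝓘(ℝ, E) 𝓘(ℝ, E) (fun y ↦ proj Γ (x * y)) 1) c v

theorem projField_bijective (x : G) : Function.Bijective (projField (E := E) Γ x) := by
  have h1 : Function.Bijective (mfderiv 𝓘(ℝ, E) 𝓘(ℝ, E) (proj Γ) x) := by
    rw [← (isLocalDiffeomorph_proj (E := E) Γ).mfderivToContinuousLinearEquiv_coe (by simp) x]
    exact ContinuousLinearEquiv.bijective _
  have h2 : Function.Bijective (mfderiv 𝓘(ℝ, E) 𝓘(ℝ, E) (fun y ↦ x * y) (1 : G)) := by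
    let e : Diffeomorph 𝓘(ℝ, E) 𝓘(ℝ, E) G G ∞ :=
      { Equiv.mulLeft x with
        contMDiff_toFun := contMDiff_mul_left
        contMDiff_invFun := contMDiff_mul_left }
    exact (e.mfderivToContinuousLinearEquiv (by simp) 1).bijective
  exact h1.comp h2

/-- The frame of `Γ \ G` induced by the left-invariant vector fields. -/
def invFrame (p : LeftQuotient Γ) :
    GroupLieAlgebra 𝓘(ℝ, E) G ≃ₗ[ℝ] TangentSpace 𝓘(ℝ, E) p :=
  LinearEquiv.ofBijective (M₂ := E)
    { toFun := projField Γ (Function.surjInv (proj_surjective Γ) p)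
      map_add' := projField_add Γ _
      map_smul' := projField_smul Γ _ } (projField_bijective Γ _)

theorem invFrame_proj (x : G) (v : GroupLieAlgebra 𝓘(ℝ, E) G) :
    (invFrame Γ (proj Γ x) v : E) =
      mfderiv 𝓘(ℝ, E) 𝓘(ℝ, E) (proj Γ) x (mulInvariantVectorField v x) :=
  projField_congr Γ (Function.surjInv_eq (proj_surjective Γ) _) v

theorem smoothAt_invFrame (v : GroupLieAlgebra 𝓘(ℝ, E) G) (p : LeftQuotient Γ) :
    SmoothAt (fun q ↦ invFrame Γ q v) p := by
  obtain ⟨x, rfl⟩ := proj_surjective Γ p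
  obtain ⟨Φ, hx, hΦ⟩ := isLocalDiffeomorph_proj (E := E) Γ x
  have hp : proj Γ x ∈ Φ.target := by rw [hΦ hx]; exact Φ.map_source hx
  have h1 : ContMDiffAt 𝓘(ℝ, E) 𝓘(ℝ, E) ∞ Φ.symm (proj Γ x) :=
    Φ.contMDiffOn_invFun.contMDiffAt (Φ.open_target.mem_nhds hp)
  have h2 := ((contMDiff_proj (E := E) Γ).contMDiff_tangentMap (m := ∞) (by simp)).contMDiffAt.comp
    _ ((smoothAt_mulInvariantVectorField v _).comp (proj Γ x) h1)
  refine h2.congr_of_eventuallyEq ?_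
  filter_upwards [Φ.open_target.mem_nhds hp] with q hq
  have hq' : Φ.symm.toPartialEquiv q ∈ Φ.source := Φ.toPartialEquiv.map_target hq
  have h3 : proj Γ (Φ.symm.toPartialEquiv q) = q :=
    (hΦ hq').trans (Φ.toPartialEquiv.right_inv hq)
  have h4 := invFrame_proj (E := E) Γ (Φ.symm.toPartialEquiv q) v
  change (⟨q, invFrame Γ q v⟩ : TangentBundle 𝓘(ℝ, E) (LeftQuotient Γ)) =
    ⟨proj Γ (Φ.symm.toPartialEquiv q), mfderiv 𝓘(ℝ, E) 𝓘(ℝ, E) (proj Γ) _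
      (mulInvariantVectorField v (Φ.symm.toPartialEquiv q))⟩
  generalize Φ.symm.toPartialEquiv q = y at *
  subst h3
  exact congrArg (fun w ↦ (⟨proj Γ y, w⟩ : TangentBundle 𝓘(ℝ, E) (LeftQuotient Γ))) h4

theorem mpullback_invFrame [CompleteSpace E] (v : GroupLieAlgebra 𝓘(ℝ, E) G) :
    mpullback 𝓘(ℝ, E) 𝓘(ℝ, E) (proj Γ) (fun q ↦ invFrame Γ q v) = mulInvariantVectorField v := by
  funext x
  have h := (isLocalDiffeomorph_proj (E := E) Γ).mfderivToContinuousLinearEquiv_coe (by simp) x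
  rw [mpullback, invFrame_proj, ← h, ContinuousLinearMap.inverse_equiv]
  exact ContinuousLinearEquiv.symm_apply_apply _ _

/-- The frame fields pull back to left-invariant fields along the local diffeomorphism `proj Γ`, and
pull-back respects brackets. -/
theorem isLieFrame_invFrame [CompleteSpace E] : IsLieFrame (invFrame (E := E) Γ) where
  smooth := smoothAt_invFrame Γ
  bracket v w p := by
    obtain ⟨x, rfl⟩ := proj_surjective Γ p
    have : IsManifold 𝓘(ℝ, E) (minSmoothness ℝ 3) (LeftQuotient Γ) := by
      rw [minSmoothness_of_isRCLikeNormedField]; infer_instance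
    have h := (isLocalDiffeomorph_proj (E := E) Γ).mfderivToContinuousLinearEquiv_coe (by simp) x
    have h1 := mpullback_mlieBracket (n := ∞) (f := proj Γ) (x₀ := x)
      (smoothAt_invFrame (E := E) Γ v _).diffAt (smoothAt_invFrame (E := E) Γ w _).diffAt
      (contMDiff_proj Γ x) (by
        rw [minSmoothness_of_isRCLikeNormedField]
        exact WithTop.coe_le_coe.2 (le_top : (2 : ℕ∞) ≤ ⊤))
    rw [mpullback_invFrame, mpullback_invFrame, ← mulInvariantVector_mlieBracket,
      ← GroupLieAlgebra.bracket_def] at h1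
    refine Eq.trans ?_ (invFrame_proj Γ x ⁅v, w⁆).symm
    rw [← h1, mpullback, ← h, ContinuousLinearMap.inverse_equiv]
    exact (ContinuousLinearEquiv.apply_symm_apply _ _).symm

end Frame

/-! ### The invariant measure of a compact quotient -/

section InvariantMeasure

open MeasureTheory VectorField

/-- The interiors of a compact exhaustion have open images that cover the compact quotient, so one
member already meets every orbit. -/
theorem exists_isCompact_smul_mem {G : Type*} [TopologicalSpace G] [Group G] (Γ : Subgroup G)
    (hopen : IsOpenMap (proj Γ)) [LocallyCompactSpace G] [SigmaCompactSpace G]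
    [CompactSpace (LeftQuotient Γ)] :
    ∃ K : Set G, IsCompact K ∧ ∀ x, ∃ γ : Γ, γ • x ∈ K := by
  let K := CompactExhaustion.choice G
  obtain ⟨n, hn⟩ := isCompact_univ.elim_directed_cover (fun n ↦ proj Γ '' interior (K n))
    (fun n ↦ hopen _ isOpen_interior) (fun p _ ↦ by
      obtain ⟨x, rfl⟩ := proj_surjective Γ p
      obtain ⟨n, hn⟩ := K.exists_mem x
      exact Set.mem_iUnion.2 ⟨n + 1, x, K.subset_interior_succ n hn, rfl⟩)
    (directed_of_isDirected_le fun m n hmn ↦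
      Set.image_mono (interior_mono (K.subset hmn)))
  refine ⟨K n, K.isCompact n, fun x ↦ ?_⟩
  obtain ⟨k, hk, hkx⟩ := hn (Set.mem_univ (proj Γ x))
  refine ⟨⟨k * x⁻¹, (proj_eq_iff Γ).1 hkx.symm⟩, ?_⟩
  simpa [Subgroup.smul_def] using interior_subset hk

variable {E : Type*} [NormedAddCommGroup E] [NormedSpace ℝ E]
  {G : Type*} [TopologicalSpace G] [ChartedSpace E G] [Group G] [LieGroup 𝓘(ℝ, E) ∞ G]
  (Γ : Subgroup G) [DiscreteTopology Γ]

theorem mvfderiv_comp_proj {u : LeftQuotient Γ → ℝ} (hu : ContMDiff 𝓘(ℝ, E) 𝓘(ℝ, ℝ) ∞ u) (x : G)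
    (v : GroupLieAlgebra 𝓘(ℝ, E) G) :
    mvfderiv 𝓘(ℝ, E) (fun y ↦ u (proj Γ y)) x (mulInvariantVectorField v x) =
      mvfderiv 𝓘(ℝ, E) u (proj Γ x) (invFrame Γ (proj Γ x) v) :=
  (mvfderiv_comp_apply_of_eq (f := proj Γ) x (hu.mdifferentiable (by simp) _)
    ((contMDiff_proj Γ).mdifferentiable (by simp) x) rfl _).trans
    (congrArg (mvfderiv 𝓘(ℝ, E) u (proj Γ x)) (invFrame_proj Γ x v).symm)

/-- A connected Lie group with a cocompact discrete subgroup is unimodular, and the compact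
quotient carries an invariant probability measure. -/
theorem trace_ad_eq_zero_and_exists_measure [FiniteDimensional ℝ E] [T2Space G] [ConnectedSpace G]
    [CompactSpace (LeftQuotient Γ)] [MeasurableSpace (LeftQuotient Γ)]
    [BorelSpace (LeftQuotient Γ)] :
    (∀ z : GroupLieAlgebra 𝓘(ℝ, E) G, LinearMap.trace ℝ (GroupLieAlgebra 𝓘(ℝ, E) G)
      (LieAlgebra.ad ℝ (GroupLieAlgebra 𝓘(ℝ, E) G) z :
        GroupLieAlgebra 𝓘(ℝ, E) G →ₗ[ℝ] GroupLieAlgebra 𝓘(ℝ, E) G) = 0) ∧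
    ∃ ν : Measure (LeftQuotient Γ), IsProbabilityMeasure ν ∧
      ∀ u : LeftQuotient Γ → ℝ, ContMDiff 𝓘(ℝ, E) 𝓘(ℝ, ℝ) ∞ u →
        ∀ v : GroupLieAlgebra 𝓘(ℝ, E) G,
          ∫ p, mvfderiv 𝓘(ℝ, E) u p (invFrame Γ p v) ∂ν = 0 := by
  have : IsTopologicalGroup G := topologicalGroup_of_lieGroup 𝓘(ℝ, E) ∞
  have : LocallyCompactSpace G := ChartedSpace.locallyCompactSpace E G
  have : SigmaCompactSpace G := sigmaCompactSpace_of_connectedSpace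
  have : SecondCountableTopology G := ChartedSpace.secondCountable_of_sigmaCompact E G
  have : Countable Γ := countable_of_Lindelof_of_discrete
  let : MeasurableSpace G := borel G
  have : BorelSpace G := ⟨rfl⟩
  let μ : Measure G := Measure.haar
  obtain ⟨K, hK, hΓK⟩ := exists_isCompact_smul_mem Γ (isLocalHomeomorph_proj (E := E) Γ).isOpenMap
  obtain ⟨F, hF, hF', hFg⟩ := exists_fundamentalDomain Γ hK hΓK μ
  have : μ.IsMulRightInvariant := isMulRightInvariant_of_fundamentalDomain Γ μ hF hF' hFg
  refine ⟨fun z ↦ trace_ad_eq_zero μ z, ?_⟩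
  have hproj : Measurable (proj Γ) := (contMDiff_proj (E := E) Γ).continuous.measurable
  have hF0 : μ F ≠ 0 := hF.measure_ne_zero (NeZero.ne μ)
  -- The normalized Haar measure of the fundamental domain, pushed down to the quotient.
  refine ⟨((μ F)⁻¹ • μ.restrict F).map (proj Γ), ?_, fun u hu v ↦ ?_⟩
  · have : IsProbabilityMeasure ((μ F)⁻¹ • μ.restrict F) :=
      ⟨by simp [ENNReal.inv_mul_cancel hF0 hF'.ne]⟩
    exact Measure.isProbabilityMeasure_map hproj.aemeasurable
  · have hc : Continuous fun p ↦ mvfderiv 𝓘(ℝ, E) u p (invFrame Γ p v) :=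
      (contMDiff_mvfderiv_apply hu (smoothAt_invFrame Γ v)).continuous
    rw [integral_map hproj.aemeasurable hc.measurable.aestronglyMeasurable, integral_smul_measure]
    have h := setIntegral_mvfderiv_eq_zero Γ μ hF hF' hFg hK hΓK
      (hu.comp (contMDiff_proj (E := E) Γ)) (fun γ x ↦ by
        simp [Subgroup.smul_def, proj_mul_left Γ γ.2]) v
    have h2 : ∀ x, mvfderiv 𝓘(ℝ, E) (u ∘ proj Γ) x (mulInvariantVectorField v x) = _ :=
      fun x ↦ mvfderiv_comp_proj Γ hu x v
    simp only [h2] at h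
    rw [h, smul_zero]

/-! ### Invariant tensors -/

theorem exists_endo_of_isLeftInvariantEndo
    {J : ∀ x : LeftQuotient Γ, TangentSpace 𝓘(ℝ, E) x →L[ℝ] TangentSpace 𝓘(ℝ, E) x}
    (hJ : IsLeftInvariantEndo Γ J) :
    ∃ J₀ : GroupLieAlgebra 𝓘(ℝ, E) G →ₗ[ℝ] GroupLieAlgebra 𝓘(ℝ, E) G,
      ∀ p v, J p (invFrame Γ p v) = invFrame Γ p (J₀ v) := by
  obtain ⟨𝒥, h1, h2⟩ := hJ
  refine ⟨(𝒥 1).toLinearMap, fun p v ↦ ?_⟩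
  obtain ⟨x, rfl⟩ := proj_surjective Γ p
  -- Left invariance at `1` lands in the fibre over `x * 1`; fibres over equal points are compared
  -- through the model space `E`.
  have h3 : ∀ y : G, y = x → ∀ w : E, (𝒥 y w : E) = 𝒥 x w := by
    rintro y rfl w; rfl
  have h4 : 𝒥 x (mulInvariantVectorField v x) = mulInvariantVectorField (𝒥 1 v) x :=
    (h3 (x * 1) (mul_one x) _).symm.trans (h2 x 1 v).symm
  refine (congrArg (J (proj Γ x)) (invFrame_proj Γ x v)).trans ?_
  refine Eq.trans ?_ (invFrame_proj Γ x _).symm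
  rw [← h1, h4]
  rfl

theorem exists_form_of_isLeftInvariantMetric {g : Metric E (LeftQuotient Γ)}
    (hg : IsLeftInvariantMetric Γ g) :
    ∃ B : GroupLieAlgebra 𝓘(ℝ, E) G →ₗ[ℝ] GroupLieAlgebra 𝓘(ℝ, E) G →ₗ[ℝ] ℝ,
      ∀ p v w, g.inner p (invFrame Γ p v) (invFrame Γ p w) = B v w := by
  let B : GroupLieAlgebra 𝓘(ℝ, E) G →ₗ[ℝ] GroupLieAlgebra 𝓘(ℝ, E) G →ₗ[ℝ] ℝ :=
    LinearMap.mk₂ ℝ (fun v w ↦ g.inner (proj Γ 1) (invFrame Γ (proj Γ 1) v)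
      (invFrame Γ (proj Γ 1) w)) (fun _ _ _ ↦ by simp) (fun _ _ _ ↦ by simp)
      (fun _ _ _ ↦ by simp) (fun _ _ _ ↦ by simp)
  have h : ∀ x v w, g.inner (proj Γ x) (invFrame Γ (proj Γ x) v) (invFrame Γ (proj Γ x) w) =
      pullbackMetric Γ g 1 v w := fun x v w ↦ by
    have h3 : ∀ y : G, y = x → ∀ v w : E, pullbackMetric Γ g y v w = pullbackMetric Γ g x v w := by
      rintro y rfl v w; rfl
    rw [← hg x 1 v w]
    refine Eq.trans ?_ (h3 (x * 1) (mul_one x) _ _).symm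
    have h4 : ∀ v, invFrame Γ (proj Γ x) v =
        mfderiv 𝓘(ℝ, E) 𝓘(ℝ, E) (proj Γ) x (mulInvariantVectorField v x) := invFrame_proj Γ x
    rw [h4, h4]
    rfl
  refine ⟨B, fun p v w ↦ ?_⟩
  obtain ⟨x, rfl⟩ := proj_surjective Γ p
  exact (h x v w).trans (h 1 v w).symm

end InvariantMeasure

/-! ### Wedge products of a one-form and a two-form -/

section Wedge

variable {L : Type*} [AddCommGroup L] [Module ℝ L] [FiniteDimensional ℝ L]

/-- Pairing a linear relation among `x`, `y`, `z` with `θ` and `σ` shows that the three-form,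
multiplied by any coefficient of the relation, vanishes. -/
theorem wedge_eq_zero_of_finrank_le_two (hL : Module.finrank ℝ L ≤ 2) (θ : L →ₗ[ℝ] ℝ)
    (σ : L →ₗ[ℝ] L →ₗ[ℝ] ℝ) (hσ : ∀ x y, σ x y = -σ y x) (x y z : L) :
    θ x * σ y z - θ y * σ x z + θ z * σ x y = 0 := by
  have hdep : ¬LinearIndependent ℝ ![x, y, z] := fun h ↦ by
    have := h.fintype_card_le_finrank
    simp at this
    omega
  obtain ⟨a, ha, i, hi⟩ := Fintype.not_linearIndependent_iff.1 hdep
  simp only [Fin.sum_univ_three, Matrix.cons_val_zero, Matrix.cons_val_one, Matrix.cons_val] at ha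
  have h0 : ∀ u, σ u u = 0 := fun u ↦ by linarith [hσ u u]
  have e1 : a 0 * θ x + a 1 * θ y + a 2 * θ z = 0 := by simpa using congrArg θ ha
  have e2 : a 0 * σ x z + a 1 * σ y z = 0 := by simpa [h0] using congrArg (σ.flip z) ha
  have e3 : a 0 * σ x y - a 2 * σ y z = 0 := by
    simpa [h0, hσ z y, sub_eq_add_neg] using congrArg (σ.flip y) ha
  have e4 : a 1 * σ x y + a 2 * σ x z = 0 := by simpa [h0] using congrArg (σ x) ha
  refine (mul_eq_zero.1 (?_ : a i * _ = 0)).resolve_left hi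
  fin_cases i
  · change a 0 * _ = 0
    linear_combination σ y z * e1 - θ y * e2 + θ z * e3
  · change a 1 * _ = 0
    linear_combination -σ x z * e1 + θ x * e2 + θ z * e4
  · change a 2 * _ = 0
    linear_combination σ x y * e1 - θ x * e3 - θ y * e4

/-- In dimension above two there is `y ≠ 0` orthogonal to `x` and `J x`; evaluating at `(x, y, J y)`
leaves `η x * B y y = 0`. -/
theorem eq_zero_of_wedge_eq_zero (hL : 2 < Module.finrank ℝ L) (J : L →ₗ[ℝ] L)
    (B : L →ₗ[ℝ] L →ₗ[ℝ] ℝ) (hpos : ∀ x, x ≠ 0 → 0 < B x x)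
    (hherm : ∀ x y, B (J x) (J y) = B x y) (η : L →ₗ[ℝ] ℝ)
    (hη : ∀ x y z, η x * B (J y) z - η y * B (J x) z + η z * B (J x) y = 0) : η = 0 := by
  ext x
  let f : L →ₗ[ℝ] ℝ × ℝ := (B x).prod (B (J x))
  obtain ⟨y, hy, hy0⟩ : ∃ y, f y = 0 ∧ y ≠ 0 := by
    have h1 : LinearMap.ker f ≠ ⊥ := LinearMap.ker_ne_bot_of_finrank_lt (by simpa using hL)
    obtain ⟨y, hy, hy0⟩ := (Submodule.ne_bot_iff _).1 h1
    exact ⟨y, hy, hy0⟩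
  have h1 : B x y = 0 := congrArg Prod.fst hy
  have h2 : B (J x) y = 0 := congrArg Prod.snd hy
  have h3 := hη x y (J y)
  rw [hherm, hherm, h1, h2, mul_zero, mul_zero, sub_zero, add_zero] at h3
  exact (mul_eq_zero.1 h3).resolve_right (hpos y hy0).ne'

end Wedge

/-! ### Lee forms and averaged potentials in an invariant frame. -/

section FrameLee

open VectorField MeasureTheory

variable {E : Type*} [NormedAddCommGroup E] [NormedSpace ℝ E]
  {M : Type*} [TopologicalSpace M] [ChartedSpace E M] [IsManifold 𝓘(ℝ, E) ∞ M]
  {L : Type*} [LieRing L] [LieAlgebra ℝ L]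
  {V : ∀ p : M, L ≃ₗ[ℝ] TangentSpace 𝓘(ℝ, E) p} {g : Metric E M} {B : L →ₗ[ℝ] L →ₗ[ℝ] ℝ}
  {J : ∀ x : M, TangentSpace 𝓘(ℝ, E) x →L[ℝ] TangentSpace 𝓘(ℝ, E) x} {J₀ : L →ₗ[ℝ] L}
  {θ : ∀ x : M, TangentSpace 𝓘(ℝ, E) x →L[ℝ] ℝ}

theorem fundamentalForm_frame (hgB : ∀ p v w, g.inner p (V p v) (V p w) = B v w)
    (hJ₀ : ∀ p v, J p (V p v) = V p (J₀ v)) (p : M) (v w : L) :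
    fundamentalForm J g p (V p v) (V p w) = B (J₀ v) w := by
  rw [fundamentalForm, hJ₀, hgB]

theorem extDeriv₂_fundamentalForm_frame (hV : IsLieFrame V)
    (hgB : ∀ p v w, g.inner p (V p v) (V p w) = B v w)
    (hJ₀ : ∀ p v, J p (V p v) = V p (J₀ v)) (p : M) (x y z : L) :
    extDeriv₂ (fundamentalForm J g) (fun q ↦ V q x) (fun q ↦ V q y) (fun q ↦ V q z) p =
      -B (J₀ ⁅x, y⁆) z + B (J₀ ⁅x, z⁆) y - B (J₀ ⁅y, z⁆) x := by
  simp only [extDeriv₂, hV.bracket, fundamentalForm_frame hgB hJ₀, mvfderiv_const]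
  simp

theorem wedge_frame (hV : IsLieFrame V) (hgB : ∀ p v w, g.inner p (V p v) (V p w) = B v w)
    (hJ₀ : ∀ p v, J p (V p v) = V p (J₀ v)) (hθ : IsLeeForm J g θ) (p : M) (x y z : L) :
    -B (J₀ ⁅x, y⁆) z + B (J₀ ⁅x, z⁆) y - B (J₀ ⁅y, z⁆) x =
      θ p (V p x) * B (J₀ y) z - θ p (V p y) * B (J₀ x) z + θ p (V p z) * B (J₀ x) y := by
  rw [← extDeriv₂_fundamentalForm_frame hV hgB hJ₀ p x y z,
    hθ.extDeriv_eq p _ _ _ (hV.smooth x p) (hV.smooth y p) (hV.smooth z p)]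
  simp only [fundamentalForm_frame hgB hJ₀]

theorem isLeeForm_zero [FiniteDimensional ℝ L] (hL : Module.finrank ℝ L ≤ 2)
    (hgB : ∀ p v w, g.inner p (V p v) (V p w) = B v w)
    (hJ₀ : ∀ p v, J p (V p v) = V p (J₀ v)) (hskew : ∀ x y, B (J₀ x) y = -B (J₀ y) x)
    (hθ : IsLeeForm J g θ) : IsLeeForm J g (fun _ ↦ 0) where
  smooth := by
    have : IsManifold 𝓘(ℝ, E) 1 M := .of_le (n := ∞) (by simp)
    exact Bundle.contMDiff_zeroSection ℝ (fun x : M ↦ TangentSpace 𝓘(ℝ, E) x →L[ℝ] ℝ)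
  closed p X Y _ _ := by simp [extDeriv₁, mvfderiv_const]
  extDeriv_eq p X Y Z hX hY hZ := by
    rw [hθ.extDeriv_eq p X Y Z hX hY hZ]
    have h := wedge_eq_zero_of_finrank_le_two hL
      ((θ p).toLinearMap ∘ₗ (V p).toLinearMap) (B ∘ₗ J₀) hskew
      ((V p).symm (X p)) ((V p).symm (Y p)) ((V p).symm (Z p))
    simp only [LinearMap.comp_apply, ← fundamentalForm_frame hgB hJ₀ p] at h
    simpa using h

theorem form_bracket_eq_zero (hV : IsLieFrame V) {θ₀ : L →ₗ[ℝ] ℝ} (hθ₀ : ∀ p v, θ p (V p v) = θ₀ v)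
    (hθ : IsLeeForm J g θ) (p : M) (v w : L) : θ₀ ⁅v, w⁆ = 0 := by
  have h := hθ.closed p _ _ (hV.smooth v p) (hV.smooth w p)
  simp only [extDeriv₁, hθ₀, hV.bracket, mvfderiv_const] at h
  simpa using h

/-- On frame fields the left side of the potential identity is constant. On the right, averaging
kills the derivatives along the frame, and the mean of `J d_θ f` on a frame field `V w` is the mean
of `f` times `θ₀ (J₀ w)`. -/
theorem integral_potential [CompactSpace M] [MeasurableSpace M] [BorelSpace M] (hV : IsLieFrame V)
    (hgB : ∀ p v w, g.inner p (V p v) (V p w) = B v w)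
    (hJ₀ : ∀ p v, J p (V p v) = V p (J₀ v)) {θ₀ : L →ₗ[ℝ] ℝ} (hθ₀ : ∀ p v, θ p (V p v) = θ₀ v)
    (ν : Measure M) [IsProbabilityMeasure ν]
    (hν : ∀ u : M → ℝ, ContMDiff 𝓘(ℝ, E) 𝓘(ℝ, ℝ) ∞ u → ∀ v,
      ∫ p, mvfderiv 𝓘(ℝ, E) u p (V p v) ∂ν = 0)
    {f : M → ℝ} (hf : ContMDiff 𝓘(ℝ, E) 𝓘(ℝ, ℝ) ∞ f)
    (hpot : ∀ (x : M) (X Y : ∀ x : M, TangentSpace 𝓘(ℝ, E) x), SmoothAt X x → SmoothAt Y x →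
      fundamentalForm J g x (X x) (Y x) = twistedDeriv₁ θ (actForm J (twistedDeriv₀ θ f)) X Y x)
    (v w : L) :
    B (J₀ v) w = -(∫ p, f p ∂ν) * θ₀ (J₀ ⁅v, w⁆) -
      (∫ p, f p ∂ν) * (θ₀ v * θ₀ (J₀ w) - θ₀ w * θ₀ (J₀ v)) := by
  let β : L → M → ℝ := fun w p ↦ -(mvfderiv 𝓘(ℝ, E) f p (V p (J₀ w)) - f p * θ₀ (J₀ w))
  have hD : ∀ u : M → ℝ, ContMDiff 𝓘(ℝ, E) 𝓘(ℝ, ℝ) ∞ u → ∀ w,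
      ContMDiff 𝓘(ℝ, E) 𝓘(ℝ, ℝ) ∞ (fun p ↦ (mvfderiv 𝓘(ℝ, E) u p (V p w) : ℝ)) := fun u hu w ↦
    contMDiff_mvfderiv_apply hu (hV.smooth w)
  have hβ : ∀ w, ContMDiff 𝓘(ℝ, E) 𝓘(ℝ, ℝ) ∞ (β w) := fun w ↦
    ((hD f hf (J₀ w)).sub (hf.mul contMDiff_const)).neg
  have hβ' : ∀ p w, actForm J (twistedDeriv₀ θ f) p (V p w) = β w p := fun p w ↦ by
    change -(mvfderiv 𝓘(ℝ, E) f p (J p (V p w)) - f p * θ p (J p (V p w))) = _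
    rw [hJ₀, hθ₀]
  have hint : ∀ u : M → ℝ, ContMDiff 𝓘(ℝ, E) 𝓘(ℝ, ℝ) ∞ u → Integrable u ν := fun u hu ↦
    hu.continuous.integrable_of_hasCompactSupport (HasCompactSupport.of_compactSpace u)
  have hIβ : ∀ w, ∫ p, β w p ∂ν = (∫ p, f p ∂ν) * θ₀ (J₀ w) := fun w ↦ by
    simp only [β]
    rw [integral_neg, integral_sub (hint _ (hD f hf _)) ((hint f hf).mul_const _), hν f hf,
      integral_mul_const]
    ring
  have heq : ∀ p, B (J₀ v) w = mvfderiv 𝓘(ℝ, E) (β w) p (V p v) -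
      mvfderiv 𝓘(ℝ, E) (β v) p (V p w) - β ⁅v, w⁆ p - (θ₀ v * β w p - θ₀ w * β v p) := fun p ↦ by
    have h := hpot p _ _ (hV.smooth v p) (hV.smooth w p)
    simp only [fundamentalForm_frame hgB hJ₀, twistedDeriv₁, extDeriv₁, hβ', hV.bracket, hθ₀] at h
    exact h
  have hI := integral_congr_ae (μ := ν) (Filter.Eventually.of_forall heq)
  have i1 := hint _ (hD _ (hβ w) v)
  have i2 := hint _ (hD _ (hβ v) w)
  have i3 := hint _ (hβ ⁅v, w⁆)
  have i4 := (hint _ (hβ w)).const_mul (θ₀ v)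
  have i5 := (hint _ (hβ v)).const_mul (θ₀ w)
  rw [integral_sub (by exact (i1.sub i2).sub i3) (by exact i4.sub i5),
    integral_sub (by exact i1.sub i2) i3,
    integral_sub i1 i2, integral_sub i4 i5, hν _ (hβ w), hν _ (hβ v), integral_const_mul,
    integral_const_mul, hIβ, hIβ, hIβ] at hI
  simp only [integral_const, probReal_univ, one_smul] at hI
  rw [hI]
  ring

theorem isVaisman_of_frame [FiniteDimensional ℝ E] [FiniteDimensional ℝ L] [Nonempty M]
    [CompactSpace M] [MeasurableSpace M] [BorelSpace M] (hV : IsLieFrame V)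
    (hgB : ∀ p v w, g.inner p (V p v) (V p w) = B v w) (hJ₀ : ∀ p v, J p (V p v) = V p (J₀ v))
    (htr : ∀ x, LinearMap.trace ℝ L (LieAlgebra.ad ℝ L x : L →ₗ[ℝ] L) = 0)
    (ν : Measure M) [IsProbabilityMeasure ν]
    (hν : ∀ u : M → ℝ, ContMDiff 𝓘(ℝ, E) 𝓘(ℝ, ℝ) ∞ u → ∀ v,
      ∫ p, mvfderiv 𝓘(ℝ, E) u p (V p v) ∂ν = 0)
    (hJ : IsComplexStructure J) (hpot : IsLcKWithPotential J g) : IsVaisman J g := by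
  obtain ⟨hherm, θ, hθ, f, hf, hpot⟩ := hpot
  refine ⟨hherm, ?_⟩
  obtain ⟨p⟩ := ‹Nonempty M›
  have hsymm : ∀ x y, B x y = B y x := fun x y ↦ by rw [← hgB p, ← hgB p, g.symm]
  have hpos : ∀ x, x ≠ 0 → 0 < B x x := fun x hx ↦ by
    rw [← hgB p]
    exact g.pos p _ fun h ↦ hx ((map_eq_zero_iff _ (V p).injective).1 h)
  have hherm₀ : ∀ x y, B (J₀ x) (J₀ y) = B x y := fun x y ↦ by
    rw [← hgB p, ← hgB p, ← hJ₀, ← hJ₀, hherm]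
  have hJJ : ∀ x, J₀ (J₀ x) = -x := fun x ↦ (V p).injective (by
    rw [← hJ₀, ← hJ₀, hJ.sq_eq_neg, map_neg])
  have hskew : ∀ x y, B (J₀ x) y = -B (J₀ y) x := fun x y ↦ by
    rw [← hherm₀ (J₀ x) y, hJJ, hsymm (J₀ y)]
    simp
  rcases le_or_gt (Module.finrank ℝ L) 2 with hL | hL
  -- Here the given `θ` need not be invariant, so it is replaced by the zero form.
  · exact ⟨_, isLeeForm_zero hL hgB hJ₀ hskew hθ, isParallel_of_ad_skew hV hgB hsymm hpos 0
      (by simp) (by simp) 0 (by simp) (by simp)⟩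
  have hint : ∀ x y : L, ⁅J₀ x, J₀ y⁆ - J₀ ⁅J₀ x, y⁆ - J₀ ⁅x, J₀ y⁆ - ⁅x, y⁆ = 0 := fun x y ↦
    (V p).injective (by
      have h := hJ.integrable p _ _ (hV.smooth x p) (hV.smooth y p)
      simp only [hJ₀, hV.bracket] at h
      rw [map_zero, ← h]
      simp only [map_sub])
  let θ₀ : L →ₗ[ℝ] ℝ := (θ p).toLinearMap ∘ₗ (V p).toLinearMap
  -- At `q` and at `p` the wedge of `θ` with `ω` equals the same constant coefficients of `dω`, so
  -- the difference of the two covectors has zero wedge with `ω`.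
  have hθ₀ : ∀ q v, θ q (V q v) = θ₀ v := fun q v ↦ by
    have h := eq_zero_of_wedge_eq_zero hL J₀ B hpos hherm₀
      ((θ q).toLinearMap ∘ₗ (V q).toLinearMap - θ₀) fun x y z ↦ by
        have h1 := wedge_frame hV hgB hJ₀ hθ q x y z
        have h2 := wedge_frame hV hgB hJ₀ hθ p x y z
        simp only [LinearMap.sub_apply, LinearMap.comp_apply, LinearEquiv.coe_coe,
          ContinuousLinearMap.coe_coe, θ₀]
        linarith
    exact sub_eq_zero.1 (DFunLike.congr_fun h v)
  have hθb : ∀ v w : L, θ₀ ⁅v, w⁆ = 0 := form_bracket_eq_zero hV hθ₀ hθ p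
  obtain ⟨A, hA⟩ : ∃ A, ∀ y, B A y = θ₀ y := by
    have hinj : Function.Injective B := (injective_iff_map_eq_zero B).2 fun x hx ↦ by
      by_contra h
      exact (hpos x h).ne' (by rw [hx]; rfl)
    obtain ⟨A, hA⟩ := (LinearMap.linearEquivOfInjective B hinj
      Subspace.dual_finrank_eq.symm).surjective θ₀
    exact ⟨A, DFunLike.congr_fun hA⟩
  refine ⟨θ, hθ, isParallel_of_ad_skew hV hgB hsymm hpos θ₀ hθ₀ hθb A hA ?_⟩
  exact ad_skew_of_potential J₀ hJJ hint B hsymm hpos hherm₀ htr θ₀ hθb _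
    (integral_potential hV hgB hJ₀ hθ₀ ν hν hf hpot)
    (fun x y z ↦ by
      have h := wedge_frame hV hgB hJ₀ hθ p x y z
      exact h) A hA

end FrameLee

end LcK

end

theorem mainTheorem6 {E : Type*} [NormedAddCommGroup E] [NormedSpace ℝ E] [FiniteDimensional ℝ E]
    {G : Type*} [TopologicalSpace G] [ChartedSpace E G] [Group G] [LieGroup 𝓘(ℝ, E) ∞ G]
    [T2Space G] [ConnectedSpace G] [Group.IsSolvable G]
    (Γ : Subgroup G) [DiscreteTopology Γ] [CompactSpace (LcK.LeftQuotient Γ)]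
    (J : ∀ x : LcK.LeftQuotient Γ, TangentSpace 𝓘(ℝ, E) x →L[ℝ] TangentSpace 𝓘(ℝ, E) x)
    (hJ : LcK.IsComplexStructure J) (hJinv : LcK.IsLeftInvariantEndo Γ J)
    (g : LcK.Metric E (LcK.LeftQuotient Γ)) (hg : LcK.IsLeftInvariantMetric Γ g)
    (hpot : LcK.IsLcKWithPotential J g) :
    LcK.IsVaisman J g := by
  have : CompleteSpace E := FiniteDimensional.complete ℝ E
  have : Nonempty (LcK.LeftQuotient Γ) := ⟨LcK.proj Γ 1⟩
  let : MeasurableSpace (LcK.LeftQuotient Γ) := borel _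
  have : BorelSpace (LcK.LeftQuotient Γ) := ⟨rfl⟩
  obtain ⟨J₀, hJ₀⟩ := LcK.exists_endo_of_isLeftInvariantEndo Γ hJinv
  obtain ⟨B, hB⟩ := LcK.exists_form_of_isLeftInvariantMetric Γ hg
  obtain ⟨htr, ν, hν, hν'⟩ := LcK.trace_ad_eq_zero_and_exists_measure (E := E) Γ
  exact LcK.isVaisman_of_frame (LcK.isLieFrame_invFrame Γ) hB hJ₀ htr ν hν' hJ hpot
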